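/- Let $\mathfrak X$ be a countably infinite alphabet containing pairwise distinct letters $x,y,t$ and $z_i,t_i$ ($i\ge 1$). For $n,m\in\mathbb N_0=\{0,1,2,\dots\}$ and a permutation $\rho$ of $\{1,\dots,n+m\}$ (the unique permutation of the empty set if $n+m=0$), let $$\mathbf c_{n,m,0}[\rho]=\Bigl(\prod_{i=1}^n z_it_i\Bigr)\,xyt\,\Bigl(\prod_{i=n+1}^{n+m} z_it_i\Bigr)\,x\,\Bigl(\prod_{i=1}^{n+m} z_{i\rho}\Bigr)\,y ,$$ where $i\rho$ is the image of $i$ under $\rho$ and empty products are the empty word. For a word $\mathbf w$, let $M(\mathbf w)$ be the factor monoid of $\mathbf w$: its elements are all factors (contiguous subwords, including the empty word) of $\mathbf w$ and a zero element $0$; the product of two factors $\mathbf u,\mathbf v$ is the concatenation $\mathbf u\mathbf v$ if this is a factor of $\mathbf w$, and $0$ otherwise; the identity element is the empty word. Let $\mathbf M(\mathbf w)$ be the variety of monoids generated by $M(\mathbf w)$, that is, the smallest class of monoids that contains $M(\mathbf w)$ and is closed under homomorphic images, submonoids and arbitrary direct products. For a variety $\mathbf V$ of monoids, let $\mathfrak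 L(\mathbf V)$ be the lattice of all subvarieties of $\mathbf V$, ordered by inclusion. Proposition. For all $n,m\in\mathbb N_0$ and all permutations $\rho\in S_{n+m}$, the lattice $\mathfrak L(\mathbf M(\mathbf c_{n,m,0}[\rho]))$ is not modular, and so it is not distributive. -/

import Mathlib

/-! ## Varieties of monoids and their lattice -/

/-- A variety of monoids: a class of monoids closed under homomorphic images, submonoids and
arbitrary direct products (the empty product being the trivial monoid). -/
@[ext]
structure MonoidVariety where
  /-- The members of the variety. -/
  carrier : Set MonCat.{0}
  image_mem : ∀ (M N : MonCat.{0}) (f : M →* N), Function.Surjective f →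
    M ∈ carrier → N ∈ carrier
  submonoid_mem : ∀ (M : MonCat.{0}) (S : Submonoid M), M ∈ carrier → MonCat.of S ∈ carrier
  pi_mem : ∀ (ι : Type) (M : ι → MonCat.{0}), (∀ i, M i ∈ carrier) →
    MonCat.of (∀ i, M i) ∈ carrier

namespace MonoidVariety

/-- The intersection of a family of varieties. -/
def inter (F : Set MonoidVariety) : MonoidVariety where
  carrier := {M | ∀ V ∈ F, M ∈ V.carrier}
  image_mem M N f hf hM V hV := V.image_mem M N f hf (hM V hV)
  submonoid_mem M S hM V hV := V.submonoid_mem M S (hM V hV)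
  pi_mem ι M hM V hV := V.pi_mem ι M fun i => hM i V hV

/-- Varieties are ordered by inclusion. -/
instance : PartialOrder MonoidVariety :=
  PartialOrder.lift carrier fun _ _ h => MonoidVariety.ext h

/-- The meet of two varieties is their intersection, and their join is the smallest variety that
contains both. -/
instance : Lattice MonoidVariety where
  inf U V :=
    { carrier := U.carrier ∩ V.carrier
      image_mem := fun M N f hf hM =>
        ⟨U.image_mem M N f hf hM.1, V.image_mem M N f hf hM.2⟩
      submonoid_mem := fun M S hM => ⟨U.submonoid_mem M S hM.1, V.submonoid_mem M S hM.2⟩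
      pi_mem := fun ι M hM =>
        ⟨U.pi_mem ι M fun i => (hM i).1, V.pi_mem ι M fun i => (hM i).2⟩ }
  inf_le_left _ _ _ h := h.1
  inf_le_right _ _ _ h := h.2
  le_inf _ _ _ h₁ h₂ _ h := ⟨h₁ h, h₂ h⟩
  sup U V := inter {W | U ≤ W ∧ V ≤ W}
  le_sup_left _ _ _ h _ hW := hW.1 h
  le_sup_right _ _ _ h _ hW := hW.2 h
  sup_le _ _ W h₁ h₂ _ h := h W ⟨h₁, h₂⟩

/-- The variety generated by a monoid. -/
def generatedBy (M : Type) [Monoid M] : MonoidVariety :=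
  inter {V | MonCat.of M ∈ V.carrier}

/-- The lattice of all subvarieties of `V`. -/
abbrev SubvarietyLattice (V : MonoidVariety) : Type 1 := Set.Iic V

end MonoidVariety

/-! ## Factor monoids -/

/-- The underlying set of the factor monoid `M(w)` of a word `w`: the factors (contiguous subwords)
of `w`, including the empty word, together with a zero element `none`. -/
def FactorMonoid {α : Type} (w : List α) : Type := Option {u : List α // u <:+: w}

namespace FactorMonoid

variable {α : Type} {w : List α}

open Classical in
/-- The class of an arbitrary word: the word itself if it is a factor of `w`, and zero otherwise. -/
noncomputable def ofWord (w u : List α) : FactorMonoid w :=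
  if h : u <:+: w then some ⟨u, h⟩ else none

/-- `u · v` is the concatenation `uv` if this is a factor of `w`, and zero otherwise; zero is
absorbing. -/
noncomputable def mul : FactorMonoid w → FactorMonoid w → FactorMonoid w
  | some u, some v => ofWord w (u.1 ++ v.1)
  | _, _ => none

theorem ofWord_of_not {u : List α} (h : ¬ u <:+: w) : ofWord w u = none := dif_neg h

theorem ofWord_val (u : {u : List α // u <:+: w}) : ofWord w u.1 = some u := dif_pos u.2

theorem none_mul (a : FactorMonoid w) : mul none a = none := by
  cases a <;> rfl

theorem mul_none (a : FactorMonoid w) : mul a none = none := by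
  cases a <;> rfl

theorem ofWord_mul (u v : List α) : mul (ofWord w u) (ofWord w v) = ofWord w (u ++ v) := by
  by_cases hu : u <:+: w
  · by_cases hv : v <:+: w
    · rw [ofWord_val ⟨u, hu⟩, ofWord_val ⟨v, hv⟩]
      rfl
    · rw [ofWord_of_not hv, mul_none, ofWord_of_not]
      exact fun h => hv ((List.suffix_append u v).isInfix.trans h)
  · rw [ofWord_of_not hu, none_mul, ofWord_of_not]
    exact fun h => hu ((List.prefix_append u v).isInfix.trans h)

noncomputable instance : Monoid (FactorMonoid w) where
  mul := mul
  one := ofWord w []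
  mul_assoc a b c := by
    change mul (mul a b) c = mul a (mul b c)
    rcases a with _ | a
    · exact (congrArg (mul · c) (none_mul b)).trans
        ((none_mul c).trans (none_mul (mul b c)).symm)
    rcases b with _ | b
    · exact (none_mul c).trans (congrArg (mul (some a)) (none_mul c)).symm
    rcases c with _ | c
    · exact (mul_none _).trans (congrArg (mul (some a)) (mul_none (some b))).symm
    rw [← ofWord_val a, ← ofWord_val b, ← ofWord_val c]
    simp only [ofWord_mul, List.append_assoc]
  one_mul a := by
    change mul (ofWord w []) a = a
    rcases a with _ | a
    · exact mul_none _
    · rw [← ofWord_val a, ofWord_mul, List.nil_append]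
  mul_one a := by
    change mul a (ofWord w []) = a
    rcases a with _ | a
    · exact none_mul _
    · rw [← ofWord_val a, ofWord_mul, List.append_nil]

end FactorMonoid

/-! ## The words -/

/-- Pairwise distinct letters `x`, `y`, `t`, `z_i`, `t_i`. -/
inductive Letter : Type
  | x : Letter
  | y : Letter
  | t : Letter
  | z : ℕ → Letter
  | ti : ℕ → Letter

open Letter in
/-- The word
`(∏_{i=1}^n z_i t_i) x y t (∏_{i=n+1}^{n+m} z_i t_i) x (∏_{i=1}^{n+m+k} z_{iτ}) y
(∏_{i=n+m+1}^{n+m+k} t_i z_i)`,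
with the indices running from `0` to `n + m + k - 1` instead of from `1` to `n + m + k`. -/
def cWord (n m k : ℕ) (τ : Equiv.Perm (Fin (n + m + k))) : List Letter :=
  (List.range n).flatMap (fun i => [z i, ti i]) ++ [x, y, t] ++
    (List.range' n m).flatMap (fun i => [z i, ti i]) ++ [x] ++
    (List.finRange (n + m + k)).map (fun i => z (τ i).val) ++ [y] ++
    (List.range' (n + m) k).flatMap (fun i => [ti i, z i])

/-! Write `V` for the variety generated by the factor monoid of `c = cWord n m 0 ρ`. The proof
exhibits four words `d i j`, with `i` and `j` Boolean (`cdWord`), that force a pentagon of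
subvarieties. The letters `x₁, y₁` and `x₂, y₂` both imitate the pair `x, y` of `c`; the index `i`
records the order of the first occurrences of `x₁, y₁`, and `j` does so for `x₂, y₂`. Deleting and
renaming letters turns `d false j` and `d i false` into `c`.

Each `d i j` is an isoterm: an identity of the factor monoid with this word on one side is trivial
(`cdWord_eq_of_sameImages`). Hence the syntactic monoid of any set of these words belongs to `V`
(`syntacticMonoid_mem`).

Within `V`, let `A` be given by `d00 ≈ d10` and `d01 ≈ d11`, `B` by `d00 ≈ d01` and `d10 ≈ d11`, and
`C ≥ A` by `d01 ≈ d11`. Three sides of the square imply the fourth, so `A ⊔ (B ⊓ C)` satisfies `d00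
≈ d10`. The syntactic monoid of `{d00}` violates this identity. It nevertheless lies in `A ⊔ B`,
since `{d00}` is the intersection of `{d00, d10}` and `{d00, d01}`, whose syntactic monoids lie in
`A` and `B`. It lies in `C` because of an asymmetry: a substitution that erases neither `x₁` nor
`y₁` and places `d i j` inside `d i' j'` forces `j = j'` (`flip₁`), so `d01 ≈ d11` cannot be applied
to `d00` with any effect. Second occurrences come in the order `x₁ x₂ … p y₂ y₁`, and the nesting is
what makes this work; for the inner pair only `flip₂` holds. -/

namespace MonoidVariety

/-! ### Identities, syntactic monoids and the pentagon -/

/-- The monoid `M` satisfies the identity `u ≈ v`. -/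
def Satisfies {X : Type} (M : Type) [Monoid M] (u v : FreeMonoid X) : Prop :=
  ∀ φ : FreeMonoid X →* M, φ u = φ v

/-- The subvariety of `V` defined within `V` by a set of identities. -/
def defined {X : Type} (V : MonoidVariety) (E : Set (FreeMonoid X × FreeMonoid X)) :
    MonoidVariety where
  carrier := {M | M ∈ V.carrier ∧ ∀ e ∈ E, Satisfies M e.1 e.2}
  image_mem M N f hf hM := by
    refine ⟨V.image_mem M N f hf hM.1, fun e he φ => ?_⟩
    let ψ : FreeMonoid X →* M :=
      FreeMonoid.lift fun i => Function.surjInv hf (φ (FreeMonoid.of i))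
    have hφ : φ = f.comp ψ := by
      ext i
      simp [ψ, Function.surjInv_eq hf]
    rw [hφ, MonoidHom.comp_apply, MonoidHom.comp_apply, hM.2 e he ψ]
  submonoid_mem M S hM := by
    refine ⟨V.submonoid_mem M S hM.1, fun e he φ => ?_⟩
    exact Subtype.ext (hM.2 e he (S.subtype.comp φ))
  pi_mem ι M hM := by
    refine ⟨V.pi_mem ι M fun i => (hM i).1, fun e he φ => ?_⟩
    exact funext fun i => (hM i).2 e he ((Pi.evalMonoidHom (fun i => M i) i).comp φ)

theorem defined_le {X : Type} (V : MonoidVariety) (E : Set (FreeMonoid X × FreeMonoid X)) :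
    V.defined E ≤ V := fun _ h => h.1

/-- The syntactic congruence of a language. -/
def syntacticCon {X : Type} (T : Set (FreeMonoid X)) : Con (FreeMonoid X) where
  r p q := ∀ l r, l * p * r ∈ T ↔ l * q * r ∈ T
  iseqv :=
    ⟨fun _ _ _ => Iff.rfl, fun h l r => (h l r).symm, fun h k l r => (h l r).trans (k l r)⟩
  mul' := by
    intro p q p' q' h k l r
    have h1 := h l (p' * r)
    have h2 := k (l * q) r
    simp only [mul_assoc] at h1 h2 ⊢
    exact h1.trans h2

/-- The syntactic monoid of a language. -/
abbrev SyntacticMonoid {X : Type} (T : Set (FreeMonoid X)) : Type := (syntacticCon T).Quotient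

variable {X : Type}

/-- A language that is a union of classes of `Con.ker φ` has a syntactic congruence coarser than
this kernel. Its syntactic monoid is thus a quotient of the range of `φ`, which is a submonoid of
`N`. -/
theorem syntacticMonoid_mem_of_ker_le {V : MonoidVariety} {N : MonCat.{0}} (hN : N ∈ V.carrier)
    (φ : FreeMonoid X →* N) {T : Set (FreeMonoid X)}
    (h : ∀ p q, φ p = φ q → p ∈ T → q ∈ T) :
    MonCat.of (SyntacticMonoid T) ∈ V.carrier := by
  have hle : Con.ker φ ≤ syntacticCon T := by
    intro p q hpq l r
    have hpq : φ p = φ q := hpq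
    constructor <;> refine h _ _ ?_ <;> simp [hpq]
  refine V.image_mem (MonCat.of (MonoidHom.mrange φ)) _
    ((Con.map _ _ hle).comp (Con.quotientKerEquivRange φ).symm.toMonoidHom) ?_
    (V.submonoid_mem N _ hN)
  have : Function.Surjective (Con.map _ _ hle) := by
    intro a
    induction a using Con.induction_on with
    | H p => exact ⟨(p : (Con.ker φ).Quotient), rfl⟩
  exact this.comp (Con.quotientKerEquivRange φ).symm.surjective

/-- The power of `M` indexed by all homomorphisms from the free monoid to `M` lies in the variety,
and the kernel of the diagonal map into it consists of the identities of `M`. -/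
theorem syntacticMonoid_mem_generatedBy {M : Type} [Monoid M] {T : Set (FreeMonoid X)}
    (h : ∀ p q, Satisfies M p q → p ∈ T → q ∈ T) :
    MonCat.of (SyntacticMonoid T) ∈ (generatedBy M).carrier := by
  have hM : MonCat.of M ∈ (generatedBy M).carrier := fun V hV => hV
  refine syntacticMonoid_mem_of_ker_le
    ((generatedBy M).pi_mem (FreeMonoid X →* M) (fun _ => MonCat.of M) fun _ => hM)
    (MonoidHom.pi fun φ => φ) fun p q hpq => h p q fun φ => congrFun hpq φ

/-- The product of the syntactic monoids recognises all the languages at once, hence also their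
intersection. -/
theorem syntacticMonoid_iInter_mem {V : MonoidVariety} {ι : Type} {T : ι → Set (FreeMonoid X)}
    (h : ∀ i, MonCat.of (SyntacticMonoid (T i)) ∈ V.carrier) :
    MonCat.of (SyntacticMonoid (⋂ i, T i)) ∈ V.carrier := by
  refine syntacticMonoid_mem_of_ker_le (V.pi_mem ι _ h)
    (MonoidHom.pi fun i => (syntacticCon (T i)).mk') fun p q hpq hp => ?_
  refine Set.mem_iInter.2 fun i => ?_
  have := (Con.eq _).1 (congrFun hpq i) 1 1
  simpa using this.1 (by simpa using Set.mem_iInter.1 hp i)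

/-- Freeness lifts every evaluation in the syntactic monoid to an endomorphism of the free monoid,
so an identity need only be tested as a rewriting rule on members of `T`. -/
theorem satisfies_syntacticMonoid {T : Set (FreeMonoid X)} {u v : FreeMonoid X}
    (h : ∀ (f : FreeMonoid X →* FreeMonoid X) (l r), l * f u * r ∈ T ↔ l * f v * r ∈ T) :
    Satisfies (SyntacticMonoid T) u v := by
  intro φ
  have hs := (syntacticCon T).mk'_surjective
  let f : FreeMonoid X →* FreeMonoid X :=
    FreeMonoid.lift fun i => Function.surjInv hs (φ (FreeMonoid.of i))
  have hφ : φ = (syntacticCon T).mk'.comp f := by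
    ext i
    simp only [MonoidHom.comp_apply, f, FreeMonoid.lift_eval_of]
    exact (Function.surjInv_eq hs _).symm
  rw [hφ]
  exact (Con.eq _).2 (h f)

theorem not_satisfies_syntacticMonoid {T : Set (FreeMonoid X)} {u v : FreeMonoid X}
    (hu : u ∈ T) (hv : v ∉ T) : ¬ Satisfies (SyntacticMonoid T) u v := by
  intro h
  have := (Con.eq _).1 (h (syntacticCon T).mk') 1 1
  exact hv (by simpa using this.1 (by simpa using hu))

/-- Four words that form a square, two of whose parallel sides are linked by one identity and the
other two by another, give rise to a pentagon of subvarieties. -/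
theorem exists_not_modular {V : MonoidVariety} {w : Bool → Bool → FreeMonoid X}
    (hne : w true false ≠ w false false) (hne' : w true false ≠ w false true)
    (hA : MonCat.of (SyntacticMonoid {w false false, w true false}) ∈ V.carrier)
    (hB : MonCat.of (SyntacticMonoid {w false false, w false true}) ∈ V.carrier)
    (hAs : ∀ j, Satisfies (SyntacticMonoid {w false false, w true false})
      (w false j) (w true j))
    (hBs : ∀ i, Satisfies (SyntacticMonoid {w false false, w false true})
      (w i false) (w i true))
    (hD : Satisfies (SyntacticMonoid {w false false}) (w false true) (w true true)) :
    ∃ a b c : V.SubvarietyLattice, a ≤ c ∧ ¬ (a ⊔ b) ⊓ c ≤ a ⊔ (b ⊓ c) := by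
  let a := V.defined {(w false false, w true false), (w false true, w true true)}
  let b := V.defined {(w false false, w false true), (w true false, w true true)}
  let c := V.defined {(w false true, w true true)}
  let e := V.defined {(w false false, w true false)}
  have hac : a ≤ c := fun M hM => ⟨hM.1, fun _ h => hM.2 _ (Or.inr h)⟩
  refine ⟨⟨a, V.defined_le _⟩, ⟨b, V.defined_le _⟩, ⟨c, V.defined_le _⟩, hac, fun hle => ?_⟩
  have hle : (a ⊔ b) ⊓ c ≤ a ⊔ (b ⊓ c) := hle
  have hae : a ≤ e := fun M hM => ⟨hM.1, fun _ h => hM.2 _ (Or.inl h)⟩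
  -- Three sides of the square imply the fourth: `w00 ≈ w01 ≈ w11 ≈ w10`.
  have hbe : b ⊓ c ≤ e := by
    rintro M ⟨hb, hc⟩
    refine ⟨hb.1, ?_⟩
    rintro _ rfl φ
    exact (hb.2 _ (Or.inl rfl) φ).trans
      ((hc.2 _ rfl φ).trans (hb.2 _ (Or.inr rfl) φ).symm)
  have hmA : MonCat.of (SyntacticMonoid {w false false, w true false}) ∈ a.carrier := by
    refine ⟨hA, ?_⟩
    rintro _ (rfl | rfl)
    exacts [hAs false, hAs true]
  have hmB : MonCat.of (SyntacticMonoid {w false false, w false true}) ∈ b.carrier := by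
    refine ⟨hB, ?_⟩
    rintro _ (rfl | rfl)
    exacts [hBs false, hBs true]
  have hI : (⋂ i : Bool, (bif i then {w false false, w true false}
      else {w false false, w false true} : Set (FreeMonoid X))) = {w false false} := by
    ext p
    simp only [Set.mem_iInter, Bool.forall_bool, cond_true, cond_false, Set.mem_insert_iff,
      Set.mem_singleton_iff]
    constructor
    · rintro ⟨h | h, h' | h'⟩
      · exact h
      · exact h
      · exact h'
      · exact absurd (h'.symm.trans h) hne'
    · intro h
      exact ⟨Or.inl h, Or.inl h⟩
  have hmI : ∀ W : MonoidVariety, a ≤ W → b ≤ W →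
      MonCat.of (SyntacticMonoid {w false false}) ∈ W.carrier := by
    intro W h1 h2
    rw [← hI]
    refine syntacticMonoid_iInter_mem fun i => ?_
    cases i
    exacts [h2 hmB, h1 hmA]
  have hmem : MonCat.of (SyntacticMonoid {w false false}) ∈ ((a ⊔ b) ⊓ c).carrier := by
    refine ⟨fun W hW => hmI W hW.1 hW.2, hmI V (V.defined_le _) (V.defined_le _), ?_⟩
    rintro _ rfl
    exact hD
  have := (sup_le hae hbe (hle hmem)).2 _ rfl
  exact not_satisfies_syntacticMonoid (T := {w false false}) rfl hne this

theorem not_modular_and_not_distrib {α : Type*} [Lattice α]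
    (h : ∃ a b c : α, a ≤ c ∧ ¬ (a ⊔ b) ⊓ c ≤ a ⊔ (b ⊓ c)) :
    ¬ IsModularLattice α ∧ ¬ ∀ A B C : α, A ⊓ (B ⊔ C) = (A ⊓ B) ⊔ (A ⊓ C) := by
  obtain ⟨a, b, c, hac, h⟩ := h
  refine ⟨fun hm => h (hm.sup_inf_le_assoc_of_le b hac), fun hd => h ?_⟩
  rw [inf_comm, hd, inf_eq_right.2 hac, inf_comm c b]

end MonoidVariety

/-! ### Evaluation of words in a factor monoid -/

namespace FactorMonoid

variable {α : Type} {w : List α}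

/-- The homomorphism from the free monoid that extends a substitution of words for letters. -/
noncomputable def eval {X : Type} (w : List α) (f : X → List α) :
    FreeMonoid X →* FactorMonoid w where
  toFun u := ofWord w (u.toList.flatMap f)
  map_one' := rfl
  map_mul' u v := by
    rw [FreeMonoid.toList_mul, List.flatMap_append]
    exact (ofWord_mul _ _).symm

theorem eq_of_ofWord_eq {u v : List α} (h : ofWord w u = ofWord w v) (hu : u <:+: w) : u = v := by
  have hu' : ofWord w u = some ⟨u, hu⟩ := dif_pos hu
  by_cases hv : v <:+: w
  · have hv' : ofWord w v = some ⟨v, hv⟩ := dif_pos hv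
    rw [hu', hv'] at h
    exact congrArg Subtype.val (Option.some.inj h)
  · rw [hu', ofWord_of_not hv] at h
    cases h

end FactorMonoid

/-! ### Precedence of letters in lists without repetition -/

namespace List

variable {α β : Type*}

theorem pair_sublist_cons_iff {a b c : α} {l : List α} :
    [a, b] <+ c :: l ↔ (a = c ∧ b ∈ l) ∨ [a, b] <+ l := by
  rw [List.sublist_cons_iff]
  constructor
  · rintro (h | ⟨r, h, hr⟩)
    · exact Or.inr h
    · injection h with h1 h2
      subst h1 h2
      exact Or.inl ⟨rfl, by simpa using hr⟩
  · rintro (⟨rfl, h⟩ | h)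
    · exact Or.inr ⟨[b], rfl, by simpa using h⟩
    · exact Or.inl h

theorem pair_sublist_append_iff {a b : α} {l₁ l₂ : List α} :
    [a, b] <+ l₁ ++ l₂ ↔ [a, b] <+ l₁ ∨ (a ∈ l₁ ∧ b ∈ l₂) ∨ [a, b] <+ l₂ := by
  induction l₁ with
  | nil => simp
  | cons c l ih =>
    rw [cons_append, pair_sublist_cons_iff, ih, pair_sublist_cons_iff]
    simp only [mem_append, mem_cons]
    tauto

theorem left_mem_of_pair_sublist {a b : α} {l : List α} (h : [a, b] <+ l) : a ∈ l :=
  h.subset (by simp)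

theorem right_mem_of_pair_sublist {a b : α} {l : List α} (h : [a, b] <+ l) : b ∈ l :=
  h.subset (by simp)

theorem Nodup.pair_sublist_asymm {l : List α} (hl : l.Nodup) {a b : α} (h : [a, b] <+ l) :
    ¬ [b, a] <+ l := by
  induction l with
  | nil => simp
  | cons c l ih =>
    rw [nodup_cons] at hl
    rw [pair_sublist_cons_iff] at h ⊢
    rintro (⟨rfl, h'⟩ | h')
    · rcases h with ⟨rfl, h⟩ | h
      exacts [hl.1 h, hl.1 (right_mem_of_pair_sublist h)]
    · rcases h with ⟨rfl, h⟩ | h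
      exacts [hl.1 (right_mem_of_pair_sublist h'), ih hl.2 h h']

theorem Nodup.pair_sublist_ne {l : List α} (hl : l.Nodup) {a b : α} (h : [a, b] <+ l) : a ≠ b := by
  rintro rfl
  exact hl.pair_sublist_asymm h h

theorem pair_sublist_total {l : List α} {a b : α} (ha : a ∈ l) (hb : b ∈ l) (hab : a ≠ b) :
    [a, b] <+ l ∨ [b, a] <+ l := by
  induction l with
  | nil => simp at ha
  | cons c l ih =>
    rw [pair_sublist_cons_iff, pair_sublist_cons_iff]
    rw [mem_cons] at ha hb
    rcases ha with rfl | ha <;> rcases hb with rfl | hb <;> tauto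

theorem Nodup.triple_sublist {l : List α} (hl : l.Nodup) {a b c : α} (h : [a, b] <+ l)
    (h' : [b, c] <+ l) : [a, b, c] <+ l := by
  induction l with
  | nil => simp at h
  | cons d l ih =>
    have hn := nodup_cons.1 hl
    rw [pair_sublist_cons_iff] at h h'
    rcases h with ⟨rfl, h⟩ | h
    · rcases h' with ⟨rfl, h'⟩ | h'
      · exact absurd h hn.1
      · exact h'.cons_cons _
    · rcases h' with ⟨rfl, h'⟩ | h'
      · exact absurd (right_mem_of_pair_sublist h) hn.1
      · exact (ih hn.2 h h').cons _

theorem Nodup.pair_sublist_trans {l : List α} (hl : l.Nodup) {a b c : α} (h : [a, b] <+ l)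
    (h' : [b, c] <+ l) : [a, c] <+ l :=
  Sublist.trans (by simp) (hl.triple_sublist h h')

theorem Nodup.not_between {l₁ l₂ : List α} {a b c : α} (hl : (l₁ ++ a :: b :: l₂).Nodup)
    (h : [a, c] <+ l₁ ++ a :: b :: l₂) : ¬ [c, b] <+ l₁ ++ a :: b :: l₂ := by
  intro h'
  have h1 := hl.triple_sublist h h'
  have hc : c ≠ b := hl.pair_sublist_ne h'
  have hca : a ≠ c := hl.pair_sublist_ne h
  have hm : c ∈ l₁ ++ a :: b :: l₂ := left_mem_of_pair_sublist h'
  simp only [mem_append, mem_cons] at hm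
  rcases hm with hm | rfl | rfl | hm
  · exact hl.pair_sublist_asymm h (pair_sublist_append_iff.2 (Or.inr (Or.inl ⟨hm, by simp⟩)))
  · exact hca rfl
  · exact hc rfl
  · refine hl.pair_sublist_asymm h' (pair_sublist_append_iff.2 (Or.inr (Or.inr ?_)))
    exact (pair_sublist_cons_iff.2 (Or.inl ⟨rfl, hm⟩)).cons _

/-- Both lists are sorted with respect to precedence in `l`, which is antisymmetric because `l` has
no repetitions; sorted permutations of each other coincide. -/
theorem eq_of_pair_sublist {l l' : List α} (hl : l.Nodup) (hp : l' ~ l)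
    (h : ∀ a b, [a, b] <+ l' → [a, b] <+ l) : l' = l := by
  refine hp.eq_of_pairwise (le := fun a b => [a, b] <+ l) ?_ ?_ ?_
  · intro a b _ _ h1 h2
    exact absurd h2 (hl.pair_sublist_asymm h1)
  · exact pairwise_iff_forall_sublist.2 fun {a b} hab => h a b hab
  · exact pairwise_iff_forall_sublist.2 fun {a b} hab => hab

theorem Sublist.flatMap_eq {l s : List α} (h : s <+ l) (hl : l.Nodup) {f : α → List β}
    (hf : ∀ a ∈ l, a ∉ s → f a = []) : l.flatMap f = s.flatMap f := by
  induction h with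
  | slnil => rfl
  | cons a hs ih =>
    have hn := nodup_cons.1 hl
    rw [flatMap_cons, hf a mem_cons_self fun ha => hn.1 (hs.subset ha), nil_append,
      ih hn.2 fun b hb => hf b (mem_cons_of_mem _ hb)]
  | cons_cons a hs ih =>
    have hn := nodup_cons.1 hl
    rw [flatMap_cons, flatMap_cons, ih hn.2 fun b hb hbs => hf b (mem_cons_of_mem _ hb) ?_]
    rw [mem_cons]
    rintro (rfl | h)
    exacts [hn.1 hb, hbs h]

end List

/-! ### Consequences of having the same images among the factors of a word -/

open List

/-- Every substitution that sends one of the words `w` and `w'` to a factor of `c` sends both words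
to the same word. -/
def SameImages {α β : Type*} (c : List β) (w w' : List α) : Prop :=
  ∀ f : α → List β, w.flatMap f <:+: c ∨ w'.flatMap f <:+: c → w.flatMap f = w'.flatMap f

theorem SameImages.symm {α β : Type*} {c : List β} {w w' : List α} (h : SameImages c w w') :
    SameImages c w' w := fun f hf => (h f hf.symm).symm

theorem MonoidVariety.Satisfies.sameImages {X α : Type} {c : List α} {p q : FreeMonoid X}
    (h : MonoidVariety.Satisfies (FactorMonoid c) p q) : SameImages c p.toList q.toList := by
  intro f hf
  have hf' : FactorMonoid.ofWord c (p.toList.flatMap f) =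
      FactorMonoid.ofWord c (q.toList.flatMap f) := h (FactorMonoid.eval c f)
  rcases hf with hf | hf
  exacts [FactorMonoid.eq_of_ofWord_eq hf' hf, (FactorMonoid.eq_of_ofWord_eq hf'.symm hf).symm]

/-- The word `c` has factors of the forms `xyvx` and `esgteg` or `esgtge`. -/
structure HasCrossings {β : Type*} (c : List β) : Prop where
  exists_return : ∃ (x y : β) (v : List β), x ≠ y ∧ x ∉ v ∧ y ∉ v ∧ x :: y :: (v ++ [x]) <:+: c
  exists_crossing : ∃ (e g : β) (s t : List β), e ≠ g ∧
    (e :: (s ++ g :: (t ++ [e, g])) <:+: c ∨ e :: (s ++ g :: (t ++ [g, e])) <:+: c)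

section

variable {α β : Type*} {c : List β}

open Classical in
theorem flatMap_ite_eq_replicate {l : List α} {k τ : α} {x : β} {v : List β} (hτ : τ ∉ l) :
    l.flatMap (fun i => if i = k then [x] else if i = τ then v else []) =
      replicate (count k l) x := by
  induction l with
  | nil => rfl
  | cons a l ih =>
    rw [mem_cons, not_or] at hτ
    rw [flatMap_cons, ih hτ.2, count_cons]
    by_cases ha : a = k
    · simp [ha, replicate_succ]
    · simp [ha, Ne.symm hτ.1]

theorem replicate_append_cons_inj {i j i' j' : ℕ} {x y : β} {v : List β} (hxy : x ≠ y)
    (h : replicate i x ++ y :: (v ++ replicate j x) = replicate i' x ++ y :: (v ++ replicate j' x)) :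
    i = i' ∧ j = j' := by
  induction i generalizing i' with
  | zero =>
    cases i' with
    | zero => simpa [List.replicate_inj] using h
    | succ i' => simp [replicate_succ, Ne.symm hxy] at h
  | succ i ih =>
    cases i' with
    | zero => simp [replicate_succ, hxy] at h
    | succ i' =>
      simp only [replicate_succ, cons_append, cons.injEq, true_and] at h
      have := ih h
      omega

open Classical in
-- Sending `k` to `x`, `τ` to `yv` and everything else to the empty word produces `x^i y v x^j`,
-- where `i` and `j` count `k` before and after `τ`. Since `i, j ≤ 1`, this is a factor of `xyvx`,
-- so both counts carry over to `w'`.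
theorem SameImages.exists_perm (hc : HasCrossings c) {F S w' : List α} {τ : α} (hF : F.Nodup)
    (hS : S.Nodup) (hτF : τ ∉ F) (hSF : S ⊆ F) (h : SameImages c (F ++ τ :: S) w') :
    ∃ F' S', w' = F' ++ τ :: S' ∧ F' ~ F ∧ S' ~ S := by
  obtain ⟨x, y, v, hxy, hxv, hyv, hfac⟩ := hc.exists_return
  have hτS : τ ∉ S := fun hm => hτF (hSF hm)
  -- Sending `τ` to `x` and erasing the rest turns a word into a power of `x` whose exponent counts
  -- `τ`.
  have hcount : count τ w' = 1 := by
    have h1 : ∀ l : List α, l.flatMap (fun i => if i = τ then [x] else []) =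
        replicate (count τ l) x := by
      intro l
      induction l with
      | nil => rfl
      | cons a l ih =>
        rw [flatMap_cons, ih, count_cons]
        by_cases ha : a = τ
        · simp [ha, replicate_succ]
        · simp [ha]
    have h2 := h (fun i => if i = τ then [x] else []) (Or.inl ?_)
    · rw [h1, h1, replicate_inj] at h2
      have : count τ (F ++ τ :: S) = 1 := by
        simp [count_append, count_eq_zero_of_not_mem hτF, count_eq_zero_of_not_mem hτS]
      omega
    · rw [h1]
      have : count τ (F ++ τ :: S) = 1 := by
        simp [count_append, count_eq_zero_of_not_mem hτF, count_eq_zero_of_not_mem hτS]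
      rw [this]
      exact IsInfix.trans ⟨[], y :: (v ++ [x]), rfl⟩ hfac
  have hmem : τ ∈ w' := count_pos_iff.1 (by omega)
  obtain ⟨F', S', rfl⟩ := append_of_mem hmem
  have hτ' : τ ∉ F' ∧ τ ∉ S' := by
    rw [count_append, count_cons_self] at hcount
    exact ⟨count_eq_zero.1 (by omega), count_eq_zero.1 (by omega)⟩
  have key : ∀ k, count k F' = count k F ∧ count k S' = count k S := by
    intro k
    by_cases hk : k = τ
    · subst hk
      rw [count_eq_zero_of_not_mem hτF, count_eq_zero_of_not_mem hτS,
        count_eq_zero_of_not_mem hτ'.1, count_eq_zero_of_not_mem hτ'.2]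
      exact ⟨rfl, rfl⟩
    · have h1 : ∀ L M : List α, τ ∉ L → τ ∉ M → (L ++ τ :: M).flatMap
          (fun i => if i = k then [x] else if i = τ then y :: v else []) =
          replicate (count k L) x ++ y :: (v ++ replicate (count k M) x) := by
        intro L M hL hM
        rw [flatMap_append, flatMap_cons, flatMap_ite_eq_replicate hL, flatMap_ite_eq_replicate hM]
        simp [Ne.symm hk]
      have h2 := h (fun i => if i = k then [x] else if i = τ then y :: v else []) (Or.inl ?_)
      · rw [h1 _ _ hτF hτS, h1 _ _ hτ'.1 hτ'.2] at h2
        have := replicate_append_cons_inj hxy h2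
        omega
      · rw [h1 _ _ hτF hτS]
        refine IsInfix.trans ?_ hfac
        have hF1 := nodup_iff_count_le_one.1 hF k
        have hS1 := nodup_iff_count_le_one.1 hS k
        have e0 : ∀ i ≤ 1, i = 0 ∨ i = 1 := by omega
        rcases e0 _ hF1 with e | e <;> rcases e0 _ hS1 with e' | e' <;> rw [e, e']
        · exact ⟨[x], [x], by simp⟩
        · exact ⟨[x], [], by simp⟩
        · exact ⟨[], [x], by simp⟩
        · exact ⟨[], [], by simp⟩
  exact ⟨F', S', rfl, perm_iff_count.2 fun k => (key k).1, perm_iff_count.2 fun k => (key k).2⟩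

open Classical in
/-- Two letters are sent to `u` and `v`, and the others to the empty word. -/
theorem flatMap_pair {l : List α} (hl : l.Nodup) {a b : α} (h : [a, b] <+ l) {f : α → List β}
    (hf : ∀ k, k ≠ a → k ≠ b → f k = []) : l.flatMap f = f a ++ f b := by
  rw [h.flatMap_eq hl]
  · simp
  · intro k _ hk
    simp only [mem_cons, not_mem_nil, or_false, not_or] at hk
    exact hf k hk.1 hk.2

open Classical in
-- With `k` sent to `x`, `s` to `yv` and the rest erased, the first word becomes `xyv` or `xyvx`, a
-- factor of `c`. If `s` preceded `k` in `F'`, the other image would begin with `y`.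
theorem SameImages.pair_simple (hc : HasCrossings c) {F F' S S' : List α} {τ : α} (hF : F.Nodup)
    (hS : S.Nodup) (hτF : τ ∉ F) (hF' : F' ~ F)
    (h : SameImages c (F ++ τ :: S) (F' ++ τ :: S')) {k s : α} (hs : s ∉ S)
    (hks : [k, s] <+ F) : [k, s] <+ F' := by
  obtain ⟨x, y, v, hxy, hxv, hyv, hfac⟩ := hc.exists_return
  have hne : k ≠ s := hF.pair_sublist_ne hks
  have hkF := left_mem_of_pair_sublist hks
  have hsF := right_mem_of_pair_sublist hks
  have hkτ : τ ≠ k := fun e => hτF (e ▸ hkF)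
  have hsτ : τ ≠ s := fun e => hτF (e ▸ hsF)
  by_contra hcon
  have hsk : [s, k] <+ F' :=
    (pair_sublist_total (hF'.mem_iff.2 hkF) (hF'.mem_iff.2 hsF) hne).resolve_left hcon
  have hFn' : F'.Nodup := hF'.nodup_iff.2 hF
  let f : α → List β := fun i => if i = k then [x] else if i = s then y :: v else []
  have hfk : f k = [x] := if_pos rfl
  have hfs : f s = y :: v := by simp [f, Ne.symm hne]
  have hfn : ∀ i, i ≠ k → i ≠ s → f i = [] := by
    intro i h1 h2
    simp [f, h1, h2]
  have hw : (F ++ τ :: S).flatMap f = x :: y :: (v ++ S.flatMap f) := by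
    rw [flatMap_append, flatMap_cons, flatMap_pair hF hks hfn, hfn τ hkτ hsτ, hfk, hfs]
    simp
  have hw' : (F' ++ τ :: S').flatMap f = y :: (v ++ x :: S'.flatMap f) := by
    rw [flatMap_append, flatMap_cons, flatMap_pair hFn' hsk fun i h1 h2 => hfn i h2 h1,
      hfn τ hkτ hsτ, hfk, hfs]
    simp
  have hSf : S.flatMap f = replicate (count k S) x := flatMap_ite_eq_replicate hs
  have := h f (Or.inl ?_)
  · rw [hw, hw'] at this
    exact hxy (by injection this)
  · rw [hw, hSf]
    have e0 : ∀ i ≤ 1, i = 0 ∨ i = 1 := by omega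
    refine IsInfix.trans ?_ hfac
    rcases e0 _ (nodup_iff_count_le_one.1 hS k) with e | e <;> rw [e]
    · exact ⟨[], [x], by simp⟩
    · exact ⟨[], [], by simp⟩

/-- The remaining implications follow from `pair_simple` by exchanging the two words and by totality
of precedence. -/
theorem SameImages.pair_simple_iff (hc : HasCrossings c) {F F' S S' : List α} {τ : α}
    (hF : F.Nodup) (hS : S.Nodup) (hτF : τ ∉ F) (hF' : F' ~ F) (hS' : S' ~ S)
    (h : SameImages c (F ++ τ :: S) (F' ++ τ :: S')) {k s : α} (hs : s ∉ S) :
    ([k, s] <+ F ↔ [k, s] <+ F') ∧ ([s, k] <+ F ↔ [s, k] <+ F') := by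
  have hFn' : F'.Nodup := hF'.nodup_iff.2 hF
  have h1 : ∀ k, [k, s] <+ F → [k, s] <+ F' := fun k =>
    h.pair_simple hc hF hS hτF hF' hs
  have h2 : ∀ k, [k, s] <+ F' → [k, s] <+ F := fun k =>
    h.symm.pair_simple hc hFn' (hS'.nodup_iff.2 hS) (fun h => hτF (hF'.mem_iff.1 h)) hF'.symm
      (fun h => hs (hS'.mem_iff.1 h))
  refine ⟨⟨h1 k, h2 k⟩, fun h3 => ?_, fun h3 => ?_⟩
  · refine (pair_sublist_total (hF'.mem_iff.2 (left_mem_of_pair_sublist h3))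
      (hF'.mem_iff.2 (right_mem_of_pair_sublist h3)) (hF.pair_sublist_ne h3)).resolve_right ?_
    exact fun h4 => hF.pair_sublist_asymm h3 (h2 k h4)
  · refine (pair_sublist_total (hF'.mem_iff.1 (left_mem_of_pair_sublist h3))
      (hF'.mem_iff.1 (right_mem_of_pair_sublist h3)) (hFn'.pair_sublist_ne h3)).resolve_right ?_
    exact fun h4 => hFn'.pair_sublist_asymm h3 (h1 k h4)

open Classical in
-- The separating letter `s` and the letter `τ` have room for the gaps of a crossing factor of `c`:
-- with `e, g, s, τ` sent to `x, y, u, v` and the rest erased, the two words become `x u y v`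
-- followed by `xy` or `yx`. Only one of the two needs to be a factor of `c`, since `SameImages` is
-- symmetric.
theorem SameImages.pair_repeated (hc : HasCrossings c) {F F' S S' : List α} {τ : α}
    (hF : F.Nodup) (hS : S.Nodup) (hτF : τ ∉ F) (hSF : S ⊆ F) (hF' : F' ~ F) (hS' : S' ~ S)
    (h : SameImages c (F ++ τ :: S) (F' ++ τ :: S')) {e s g : α} (he : e ∈ S) (hs : s ∉ S)
    (hg : g ∈ S) (hesg : [e, s, g] <+ F) : ([e, g] <+ S' ↔ [e, g] <+ S) ∧
      ([g, e] <+ S' ↔ [g, e] <+ S) := by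
  obtain ⟨x, y, u, v, hxy, hfac⟩ := hc.exists_crossing
  have hFn' : F'.Nodup := hF'.nodup_iff.2 hF
  have hSn' : S'.Nodup := hS'.nodup_iff.2 hS
  have h1 : [e, s] <+ F := Sublist.trans (by simp) hesg
  have h2 : [s, g] <+ F := Sublist.trans (by simp) hesg
  have h1' := ((h.pair_simple_iff hc hF hS hτF hF' hS' hs).1).1 h1
  have h2' := ((h.pair_simple_iff hc hF hS hτF hF' hS' hs).2).1 h2
  have hesg' := hFn'.triple_sublist h1' h2'
  have hes : e ≠ s := hF.pair_sublist_ne h1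
  have hsg : s ≠ g := hF.pair_sublist_ne h2
  have heg : e ≠ g := hF.pair_sublist_ne (hF.pair_sublist_trans h1 h2)
  have hmem : ∀ i, i ∈ [e, s, g] → i ∈ F := fun i hi => hesg.subset hi
  have hne : ∀ i, i ∈ F → τ ≠ i := fun i hi e => hτF (e ▸ hi)
  have heτ := hne e (hmem e (by simp))
  have hsτ := hne s (hmem s (by simp))
  have hgτ := hne g (hmem g (by simp))
  let f : α → List β := fun i =>
    if i = e then [x] else if i = g then [y] else if i = s then u else if i = τ then v else []
  have hfe : f e = [x] := if_pos rfl
  have hfg : f g = [y] := by simp [f, Ne.symm heg]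
  have hfs : f s = u := by simp [f, Ne.symm hes, hsg]
  have hfτ : f τ = v := by simp [f, heτ, hsτ, hgτ]
  have hfn : ∀ i, i ≠ e → i ≠ g → i ≠ s → i ≠ τ → f i = [] := by
    intro i h1 h2 h3 h4
    simp [f, h1, h2, h3, h4]
  have hFf : ∀ L : List α, L.Nodup → [e, s, g] <+ L → τ ∉ L → L.flatMap f = x :: (u ++ [y]) := by
    intro L hL hs hτ
    rw [hs.flatMap_eq hL]
    · simp [hfe, hfs, hfg]
    · intro i hi hi'
      simp only [mem_cons, not_mem_nil, or_false, not_or] at hi'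
      exact hfn i hi'.1 hi'.2.2 hi'.2.1 fun e => hτ (e ▸ hi)
  have hSf : ∀ L : List α, L.Nodup → s ∉ L → τ ∉ L →
      ([e, g] <+ L → L.flatMap f = [x, y]) ∧ ([g, e] <+ L → L.flatMap f = [y, x]) := by
    intro L hL hs hτ
    constructor
    all_goals
      intro hp
      rw [hp.flatMap_eq hL]
      · simp [hfe, hfg]
      · intro i hi hi'
        simp only [mem_cons, not_mem_nil, or_false, not_or] at hi'
        have h1 : i ≠ s := fun e => hs (e ▸ hi)
        have h2 : i ≠ τ := fun e => hτ (e ▸ hi)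
        first
          | exact hfn i hi'.1 hi'.2 h1 h2
          | exact hfn i hi'.2 hi'.1 h1 h2
  have hτS : τ ∉ S := fun h => hτF (hSF h)
  have hτF' : τ ∉ F' := fun h => hτF (hF'.mem_iff.1 h)
  have hτS' : τ ∉ S' := fun h => hτS (hS'.mem_iff.1 h)
  have hs' : s ∉ S' := fun h => hs (hS'.mem_iff.1 h)
  have hw : (F ++ τ :: S).flatMap f = x :: (u ++ y :: (v ++ S.flatMap f)) := by
    rw [flatMap_append, flatMap_cons, hFf F hF hesg hτF, hfτ]
    simp
  have hw' : (F' ++ τ :: S').flatMap f = x :: (u ++ y :: (v ++ S'.flatMap f)) := by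
    rw [flatMap_append, flatMap_cons, hFf F' hFn' hesg' hτF', hfτ]
    simp
  have hfin : S.flatMap f = S'.flatMap f := by
    have hiff : x :: (u ++ y :: (v ++ S.flatMap f)) <:+: c ∨
        x :: (u ++ y :: (v ++ S'.flatMap f)) <:+: c → S.flatMap f = S'.flatMap f := by
      intro hh
      have := h f (by rw [hw, hw']; exact hh)
      rw [hw, hw'] at this
      simpa using this
    have hS1 := hSf S hS hs hτS
    have hS2 := hSf S' hSn' hs' hτS'
    rcases pair_sublist_total he hg heg with h3 | h3 <;>
      rcases pair_sublist_total (hS'.mem_iff.2 he) (hS'.mem_iff.2 hg) heg with h4 | h4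
    · rw [hS1.1 h3, hS2.1 h4]
    · rw [hS1.1 h3, hS2.2 h4] at hiff ⊢
      exact hiff hfac
    · rw [hS1.2 h3, hS2.1 h4] at hiff ⊢
      exact hiff hfac.symm
    · rw [hS1.2 h3, hS2.2 h4]
  have hS1 := hSf S hS hs hτS
  have hS2 := hSf S' hSn' hs' hτS'
  have hxy' : [x, y] ≠ [y, x] := by
    intro h
    injection h with h _
    exact hxy h
  rcases pair_sublist_total he hg heg with h3 | h3 <;>
    rcases pair_sublist_total (hS'.mem_iff.2 he) (hS'.mem_iff.2 hg) heg with h4 | h4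
  · exact ⟨iff_of_true h4 h3,
      iff_of_false (hSn'.pair_sublist_asymm h4) (hS.pair_sublist_asymm h3)⟩
  · rw [hS1.1 h3, hS2.2 h4] at hfin
    exact absurd hfin hxy'
  · rw [hS1.2 h3, hS2.1 h4] at hfin
    exact absurd hfin.symm hxy'
  · exact ⟨iff_of_false (hSn'.pair_sublist_asymm h4) (hS.pair_sublist_asymm h3),
      iff_of_true h4 h3⟩

/-- A word `F τ S`, where neither `F` nor `S` has repeated letters and all letters of `S` occur
in `F`, is determined by its images up to the order of those pairs of repeated letters which are
not separated by a simple letter in `F`. -/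
theorem SameImages.eq_append (hc : HasCrossings c) {F S w' : List α} {τ : α} {T : α → α → Prop}
    (hF : F.Nodup) (hS : S.Nodup) (hτF : τ ∉ F) (hSF : S ⊆ F)
    (hT : ∀ a b, T a b → T b a)
    (hsep : ∀ e ∈ S, ∀ g ∈ S, [e, g] <+ F → ¬ T e g → ∃ s, s ∉ S ∧ [e, s, g] <+ F)
    (htwin : ∀ e g, T e g → [e, g] <+ S → ∃ q, ¬ T e q ∧ ¬ T q g ∧ [e, q] <+ S ∧ [q, g] <+ S)
    (h : SameImages c (F ++ τ :: S) w') :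
    ∃ F', w' = F' ++ τ :: S ∧ F' ~ F ∧ ∀ a b, [a, b] <+ F' → [a, b] <+ F ∨ T a b := by
  obtain ⟨F', S', rfl, hF', hS'⟩ := h.exists_perm hc hF hS hτF hSF
  have hFn' : F'.Nodup := hF'.nodup_iff.2 hF
  have hSn' : S'.Nodup := hS'.nodup_iff.2 hS
  have hrep : ∀ e g, ¬ T e g → [e, g] <+ S → [e, g] <+ S' := by
    intro e g hT' heg
    have he := left_mem_of_pair_sublist heg
    have hg := right_mem_of_pair_sublist heg
    rcases pair_sublist_total (hSF he) (hSF hg) (hS.pair_sublist_ne heg) with h1 | h1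
    · obtain ⟨s, hs, hesg⟩ := hsep e he g hg h1 hT'
      exact (h.pair_repeated hc hF hS hτF hSF hF' hS' he hs hg hesg).1.2 heg
    · obtain ⟨s, hs, hesg⟩ := hsep g hg e he h1 fun h => hT' (hT _ _ h)
      exact (h.pair_repeated hc hF hS hτF hSF hF' hS' hg hs he hesg).2.2 heg
  -- Pairs outside `T` keep their order by `hrep`; a pair in `T` is compared through the
  -- intermediate letter `q`.
  have hSS : S = S' := by
    refine eq_of_pair_sublist hSn' hS'.symm fun e g heg => ?_
    by_cases hT' : T e g
    · obtain ⟨q, h1, h2, h3, h4⟩ := htwin e g hT' heg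
      exact hSn'.pair_sublist_trans (hrep _ _ h1 h3) (hrep _ _ h2 h4)
    · exact hrep e g hT' heg
  subst hSS
  refine ⟨F', rfl, hF', fun a b hab => ?_⟩
  by_cases hbS : b ∈ S
  · by_cases haS : a ∈ S
    -- A separating simple letter keeps its place relative to both letters, and therefore fixes
    -- their mutual order in `F'`.
    · by_contra! hcon
      have hba : [b, a] <+ F := (pair_sublist_total (hSF haS) (hSF hbS)
        (hFn'.pair_sublist_ne hab)).resolve_left hcon.1
      obtain ⟨s, hs, hbsa⟩ := hsep b hbS a haS hba fun h => hcon.2 (hT _ _ h)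
      have hiff := fun k => h.pair_simple_iff hc hF hS hτF hF' hS' (k := k) hs
      have h1 := (hiff b).1.1 (Sublist.trans (by simp) hbsa)
      have h2 := (hiff a).2.1 (Sublist.trans (by simp) hbsa)
      exact hFn'.pair_sublist_asymm hab (hFn'.pair_sublist_trans h1 h2)
    · exact Or.inl ((h.pair_simple_iff hc hF hS hτF hF' hS' haS).2.2 hab)
  · exact Or.inl ((h.pair_simple_iff hc hF hS hτF hF' hS' hbS).1.2 hab)

end

/-! ### The four words and the order of their letters -/

/-- The letters of the words `dWord`: the letters `x₁, y₁, x₂, y₂, p, a k` occur twice, and the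
others once. -/
inductive DLetter : Type
  | x₁ : DLetter
  | y₁ : DLetter
  | x₂ : DLetter
  | y₂ : DLetter
  | p : DLetter
  | t₁ : DLetter
  | t₂ : DLetter
  | t₃ : DLetter
  | t₄ : DLetter
  | a : ℕ → DLetter
  | b : ℕ → DLetter

namespace DLetter

/-- The word `∏ aₖ bₖ`, with `k` running through `l`. -/
def pairWord (l : List ℕ) : List DLetter := l.flatMap fun k => [a k, b k]

/-- The word `uv` or `vu`. -/
def swapIf (i : Bool) (u v : DLetter) : List DLetter := bif i then [v, u] else [u, v]

/-- The part of `dWord` with the first occurrences of the letters. -/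
def fWord (i j : Bool) (is js : List ℕ) : List DLetter :=
  pairWord is ++ (swapIf i x₁ y₁ ++ t₁ :: p :: t₂ :: (swapIf j x₂ y₂ ++ t₃ :: pairWord js))

/-- The part of `dWord` with the second occurrences of the letters. -/
def sWord (ks : List ℕ) : List DLetter := x₁ :: x₂ :: (ks.map a ++ [p, y₂, y₁])

/-- The word `(∏ aₖ bₖ) x₁ y₁ t₁ p t₂ x₂ y₂ t₃ (∏ aₖ bₖ) t₄ x₁ x₂ (∏ aₖ) p y₂ y₁`, where the first
occurrences of `x₁` and `y₁` are swapped if `i` is true, and those of `x₂` and `y₂` if `j` is. -/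
def dWord (i j : Bool) (is js ks : List ℕ) : List DLetter := fWord i j is js ++ t₄ :: sWord ks

/-- Letters whose first occurrences may be adjacent. -/
def Twin (u v : DLetter) : Prop :=
  (u = x₁ ∧ v = y₁) ∨ (u = y₁ ∧ v = x₁) ∨ (u = x₂ ∧ v = y₂) ∨ (u = y₂ ∧ v = x₂)

theorem Twin.symm {u v : DLetter} (h : Twin u v) : Twin v u := by
  unfold Twin at h ⊢
  tauto

theorem mem_swapIf {i : Bool} {u v w : DLetter} : w ∈ swapIf i u v ↔ w = u ∨ w = v := by
  cases i <;> simp [swapIf, or_comm]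

theorem mem_pairWord {l : List ℕ} {u : DLetter} :
    u ∈ pairWord l ↔ ∃ k ∈ l, u = a k ∨ u = b k := by
  simp [pairWord]

@[simp]
theorem pairWord_cons {k : ℕ} {l : List ℕ} : pairWord (k :: l) = a k :: b k :: pairWord l := rfl

theorem pairWord_nodup {l : List ℕ} (hl : l.Nodup) : (pairWord l).Nodup := by
  induction l with
  | nil => exact nodup_nil
  | cons k l ih =>
    rw [nodup_cons] at hl
    rw [pairWord_cons, nodup_cons, nodup_cons]
    refine ⟨?_, ?_, ih hl.2⟩ <;> simp [mem_pairWord, hl.1]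

/-- The letter `b k` comes immediately after `a k`, so whatever else follows `a k` also follows `b
k`. -/
theorem pair_sublist_pairWord {l : List ℕ} {k : ℕ} {g : DLetter} (hg : g ≠ b k)
    (h : [a k, g] <+ pairWord l) : [b k, g] <+ pairWord l := by
  induction l with
  | nil => simp [pairWord] at h
  | cons i l ih =>
    simp only [pairWord_cons, pair_sublist_cons_iff, a.injEq, mem_cons, reduceCtorEq, false_and,
      false_or, b.injEq] at h ⊢
    rcases h with ⟨rfl, h | h⟩ | h
    exacts [absurd h hg, Or.inl ⟨rfl, h⟩, Or.inr (ih h)]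

section

variable {is js ks : List ℕ}

theorem mem_sWord {u : DLetter} :
    u ∈ sWord ks ↔ u = x₁ ∨ u = x₂ ∨ (∃ k ∈ ks, u = a k) ∨ u = p ∨ u = y₂ ∨ u = y₁ := by
  simp [sWord, eq_comm]

theorem mem_fWord {i j : Bool} {u : DLetter} :
    u ∈ fWord i j is js ↔ u ∈ pairWord is ∨ u = x₁ ∨ u = y₁ ∨ u = t₁ ∨ u = p ∨ u = t₂ ∨
      u = x₂ ∨ u = y₂ ∨ u = t₃ ∨ u ∈ pairWord js := by
  simp only [fWord, mem_append, mem_cons, mem_swapIf]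
  tauto

theorem fWord_nodup (h : (is ++ js).Nodup) (i j : Bool) : (fWord i j is js).Nodup := by
  have h' := nodup_append.1 h
  have hd : ∀ k ∈ is, k ∉ js := fun k h1 h2 => h'.2.2 k h1 k h2 rfl
  have h1 := pairWord_nodup h'.1
  have h2 := pairWord_nodup h'.2.1
  cases i <;> cases j <;>
    simp [fWord, swapIf, nodup_append, h1, h2, mem_pairWord] <;>
    rintro _ k hk (rfl | rfl) <;> simp <;> grind

theorem sWord_nodup (h : ks.Nodup) : (sWord ks).Nodup := by
  have : (ks.map a).Nodup := h.map fun _ _ h => by injection h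
  simp only [sWord, nodup_cons, nodup_append]
  simp [this]

theorem t₄_notMem_fWord {i j : Bool} : t₄ ∉ fWord i j is js := by
  simp [mem_fWord, mem_pairWord]

theorem sWord_subset_fWord {i j : Bool} (hk : ks ~ is ++ js) : sWord ks ⊆ fWord i j is js := by
  intro u hu
  rw [mem_sWord] at hu
  rw [mem_fWord, mem_pairWord, mem_pairWord]
  rcases hu with h | h | ⟨k, hk', rfl⟩ | h | h | h
  any_goals tauto
  rw [hk.mem_iff, mem_append] at hk'
  rcases hk' with h | h
  exacts [Or.inl ⟨k, h, Or.inl rfl⟩, by iterate 8 right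
                                        exact Or.inr ⟨k, h, Or.inl rfl⟩]

theorem pair_sublist_swapIf {i : Bool} {u v e g : DLetter} :
    [e, g] <+ swapIf i u v ↔ bif i then e = v ∧ g = u else e = u ∧ g = v := by
  cases i <;> simp [swapIf, pair_sublist_cons_iff]

/-- Every repeated letter is followed in `fWord` by a simple letter with at most its twin in
between: `t₁` serves `x₁` and `y₁`, `t₃` serves `x₂` and `y₂`, `t₂` serves `p`, and `b k` serves `a
k`. -/
theorem exists_separator {i j : Bool} (hd : (is ++ js).Nodup) {e g : DLetter}
    (he : e ∈ sWord ks) (hg : g ∈ sWord ks) (h : [e, g] <+ fWord i j is js) (ht : ¬ Twin e g) :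
    ∃ s, s ∉ sWord ks ∧ [e, s, g] <+ fWord i j is js := by
  suffices H : ∃ s, s ∉ sWord ks ∧ [e, s] <+ fWord i j is js ∧ [s, g] <+ fWord i j is js by
    obtain ⟨s, h1, h2, h3⟩ := H
    exact ⟨s, h1, (fWord_nodup hd i j).triple_sublist h2 h3⟩
  have hgb : ∀ k, g ≠ b k := by
    rintro k rfl
    simp [mem_sWord] at hg
  have hgt : g ≠ t₁ ∧ g ≠ t₂ ∧ g ≠ t₃ := by
    refine ⟨?_, ?_, ?_⟩ <;> rintro rfl <;> simp [mem_sWord] at hg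
  have hne := (fWord_nodup hd i j).pair_sublist_ne h
  have hP : ∀ (l : List ℕ) (u : DLetter), [u, g] <+ pairWord l → u ∈ pairWord l :=
    fun _ _ h => left_mem_of_pair_sublist h
  rcases mem_sWord.1 he with rfl | rfl | ⟨k, hk, rfl⟩ | rfl | rfl | rfl
  · refine ⟨t₁, by simp [mem_sWord], ?_⟩
    have h1 := fun l => hP l x₁
    simp only [mem_pairWord] at h1
    cases i <;> cases j <;> simp_all [fWord, swapIf, pair_sublist_append_iff, pair_sublist_cons_iff,
      Twin, mem_pairWord]
  · refine ⟨t₃, by simp [mem_sWord], ?_⟩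
    have h1 := fun l => hP l x₂
    simp only [mem_pairWord] at h1
    cases i <;> cases j <;> simp_all [fWord, swapIf, pair_sublist_append_iff, pair_sublist_cons_iff,
      Twin, mem_pairWord]
  · refine ⟨b k, by simp [mem_sWord], ?_⟩
    have h1 := fun l => @pair_sublist_pairWord l k g (hgb k)
    have h2 : ∀ l, k ∈ l → [a k, b k] <+ pairWord l := by
      intro l hl
      induction l with
      | nil => simp at hl
      | cons i l ih =>
        rcases mem_cons.1 hl with rfl | hl
        · simp
        · exact ((ih hl).cons _).cons _
    have h3 := fun l => hP l (a k)
    simp only [mem_pairWord] at h3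
    simp only [fWord, pair_sublist_append_iff, pair_sublist_cons_iff, pair_sublist_swapIf,
      mem_pairWord, mem_append, mem_cons, mem_swapIf] at h ⊢
    cases i <;> cases j <;> simp_all <;> grind
  · refine ⟨t₂, by simp [mem_sWord], ?_⟩
    have h1 := fun l => hP l p
    simp only [mem_pairWord] at h1
    cases i <;> cases j <;> simp_all [fWord, swapIf, pair_sublist_append_iff, pair_sublist_cons_iff,
      Twin, mem_pairWord]
  · refine ⟨t₃, by simp [mem_sWord], ?_⟩
    have h1 := fun l => hP l y₂
    simp only [mem_pairWord] at h1
    cases i <;> cases j <;> simp_all [fWord, swapIf, pair_sublist_append_iff, pair_sublist_cons_iff,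
      Twin, mem_pairWord]
  · refine ⟨t₁, by simp [mem_sWord], ?_⟩
    have h1 := fun l => hP l y₁
    simp only [mem_pairWord] at h1
    cases i <;> cases j <;> simp_all [fWord, swapIf, pair_sublist_append_iff, pair_sublist_cons_iff,
      Twin, mem_pairWord]

/-- In `sWord` the letter `p` lies between the members of each twin pair, even when `ks` is empty.
-/
theorem exists_between {e g : DLetter} (hk : ks.Nodup) (ht : Twin e g) (h : [e, g] <+ sWord ks) :
    ∃ q, ¬ Twin e q ∧ ¬ Twin q g ∧ [e, q] <+ sWord ks ∧ [q, g] <+ sWord ks := by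
  refine ⟨p, by simp [Twin], by simp [Twin], ?_⟩
  have hn := (sWord_nodup hk).pair_sublist_asymm h
  rcases ht with ⟨rfl, rfl⟩ | ⟨rfl, rfl⟩ | ⟨rfl, rfl⟩ | ⟨rfl, rfl⟩
  · simp [sWord, pair_sublist_append_iff]
  · simp [sWord] at hn
  · simp [sWord, pair_sublist_append_iff]
  · simp [sWord] at hn

theorem pair_sublist_fWord_of_not_twin {i j i' j' : Bool} {u v : DLetter} (ht : ¬ Twin u v)
    (h : [u, v] <+ fWord i j is js) : [u, v] <+ fWord i' j' is js := by
  have hs : ∀ i u₀ v₀, Twin u₀ v₀ → ¬ [u, v] <+ swapIf i u₀ v₀ := by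
    intro i u₀ v₀ ht' h
    rw [pair_sublist_swapIf] at h
    cases i
    · exact ht (h.1 ▸ h.2 ▸ ht')
    · exact ht (h.1 ▸ h.2 ▸ ht'.symm)
  have h1 : Twin x₁ y₁ := by simp [Twin]
  have h2 : Twin x₂ y₂ := by simp [Twin]
  simp only [fWord, pair_sublist_append_iff, pair_sublist_cons_iff, mem_append, mem_cons,
    mem_swapIf, hs _ _ _ h1, hs _ _ _ h2] at h ⊢
  exact h

open Classical in
-- Only the order within each of the two twin pairs is free, and the two Booleans are read off from
-- it.
theorem eq_fWord_of_pair_sublist (hd : (is ++ js).Nodup) {i j : Bool} {F : List DLetter}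
    (hF : F ~ fWord i j is js)
    (h : ∀ u v, [u, v] <+ F → [u, v] <+ fWord i j is js ∨ Twin u v) :
    ∃ i' j', F = fWord i' j' is js := by
  have hFn : F.Nodup := hF.nodup_iff.2 (fWord_nodup hd i j)
  refine ⟨decide ([y₁, x₁] <+ F), decide ([y₂, x₂] <+ F),
    eq_of_pair_sublist (fWord_nodup hd _ _) ?_ fun u v huv => ?_⟩
  · refine hF.trans ((perm_ext_iff_of_nodup (fWord_nodup hd _ _) (fWord_nodup hd _ _)).2 ?_)
    intro u
    rw [mem_fWord, mem_fWord]
  · by_cases ht : Twin u v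
    · have hn := hFn.pair_sublist_asymm huv
      rcases ht with ⟨rfl, rfl⟩ | ⟨rfl, rfl⟩ | ⟨rfl, rfl⟩ | ⟨rfl, rfl⟩
      · simp [fWord, pair_sublist_swapIf, hn]
      · simp [fWord, pair_sublist_swapIf, huv]
      · simp [fWord, pair_sublist_append_iff, pair_sublist_cons_iff, pair_sublist_swapIf, hn]
      · simp [fWord, pair_sublist_append_iff, pair_sublist_cons_iff, pair_sublist_swapIf, huv]
    · exact pair_sublist_fWord_of_not_twin ht ((h u v huv).resolve_right ht)

end

end DLetter

/-! ### The four words are isoterms -/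

theorem cWord_zero (n m : ℕ) (ρ : Equiv.Perm (Fin (n + m))) :
    cWord n m 0 ρ = (range n).flatMap (fun i => [Letter.z i, Letter.ti i]) ++
      (Letter.x :: Letter.y :: Letter.t ::
        ((range' n m).flatMap (fun i => [Letter.z i, Letter.ti i]) ++ Letter.x ::
          ((finRange (n + m)).map (fun i => Letter.z (ρ i).val) ++ [Letter.y]))) := by
  simp [cWord]

theorem hasCrossings_cWord (n m : ℕ) (ρ : Equiv.Perm (Fin (n + m))) :
    HasCrossings (cWord n m 0 ρ) := by
  rw [cWord_zero]
  constructor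
  · refine ⟨Letter.x, Letter.y,
      Letter.t :: (range' n m).flatMap (fun i => [Letter.z i, Letter.ti i]), by simp, by simp,
      by simp, (range n).flatMap (fun i => [Letter.z i, Letter.ti i]),
      (finRange (n + m)).map (fun i => Letter.z (ρ i).val) ++ [Letter.y], by simp⟩
  -- The crossing ends with the second `x` and the letter after it: `y` if there are no `z`'s, and
  -- otherwise the first letter of the permuted block. Whether the first occurrence of that `z` is
  -- before or after the first `x` decides between the two forms.
  · by_cases hnm : n + m = 0
    · obtain ⟨rfl, rfl⟩ : n = 0 ∧ m = 0 := by omega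
      exact ⟨Letter.x, Letter.y, [], [Letter.t], by simp, Or.inl ⟨[], [], by simp⟩⟩
    · have hne : finRange (n + m) ≠ [] := by simpa using hnm
      obtain ⟨i, l, hil⟩ := exists_cons_of_ne_nil hne
      rw [hil]
      have hmem : (ρ i).val ∈ range n ∨ (ρ i).val ∈ range' n m := by
        have := (ρ i).isLt
        simp only [mem_range, mem_range'_1]
        omega
      rcases hmem with h | h
      · obtain ⟨l₁, l₂, h⟩ := append_of_mem h
        rw [h]
        refine ⟨Letter.z (ρ i).val, Letter.x, Letter.ti (ρ i).val ::
          l₂.flatMap (fun i => [Letter.z i, Letter.ti i]), Letter.y :: Letter.t ::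
          (range' n m).flatMap (fun i => [Letter.z i, Letter.ti i]), by simp, Or.inr ?_⟩
        exact ⟨l₁.flatMap (fun i => [Letter.z i, Letter.ti i]),
          l.map (fun i => Letter.z (ρ i).val) ++ [Letter.y], by simp⟩
      · obtain ⟨l₁, l₂, h⟩ := append_of_mem h
        rw [h]
        refine ⟨Letter.x, Letter.z (ρ i).val, Letter.y :: Letter.t ::
          l₁.flatMap (fun i => [Letter.z i, Letter.ti i]), Letter.ti (ρ i).val ::
          l₂.flatMap (fun i => [Letter.z i, Letter.ti i]), by simp, Or.inl ?_⟩
        exact ⟨(range n).flatMap (fun i => [Letter.z i, Letter.ti i]),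
          l.map (fun i => Letter.z (ρ i).val) ++ [Letter.y], by simp⟩

namespace DLetter

/-- The substitution that deletes `x₂, y₂, p` and some of the simple letters. -/
def toLetter₁ : DLetter → List Letter
  | x₁ => [Letter.x]
  | y₁ => [Letter.y]
  | t₁ => [Letter.t]
  | a k => [Letter.z k]
  | b k => [Letter.ti k]
  | _ => []

/-- The substitution that deletes `x₁, y₁, p` and some of the simple letters. -/
def toLetter₂ : DLetter → List Letter
  | x₂ => [Letter.x]
  | y₂ => [Letter.y]
  | t₃ => [Letter.t]
  | a k => [Letter.z k]
  | b k => [Letter.ti k]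
  | _ => []

variable (n m : ℕ) (ρ : Equiv.Perm (Fin (n + m)))

/-- The word `dWord` for the parameters of `cWord n m 0 ρ`. -/
def cdWord (i j : Bool) : List DLetter :=
  dWord i j (range n) (range' n m) ((finRange (n + m)).map fun k => (ρ k).val)

theorem flatMap_toLetter₁_pairWord (l : List ℕ) :
    (pairWord l).flatMap toLetter₁ = l.flatMap fun i => [Letter.z i, Letter.ti i] := by
  simp [pairWord, flatMap_assoc, toLetter₁]

theorem flatMap_toLetter₂_pairWord (l : List ℕ) :
    (pairWord l).flatMap toLetter₂ = l.flatMap fun i => [Letter.z i, Letter.ti i] := by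
  simp [pairWord, flatMap_assoc, toLetter₂]

theorem flatMap_toLetter₁_false (j : Bool) :
    (cdWord n m ρ false j).flatMap toLetter₁ = cWord n m 0 ρ := by
  have : ∀ l : List (Fin (n + m)), (l.map (a ∘ fun k => (ρ k).val)).flatMap toLetter₁ =
      l.map (fun i => Letter.z (ρ i).val) := by
    intro l
    induction l with
    | nil => rfl
    | cons k l ih => simp [toLetter₁, ih]
  rw [cWord_zero]
  cases j <;> simp [cdWord, dWord, fWord, sWord, swapIf, flatMap_toLetter₁_pairWord, this] <;>
    simp [toLetter₁]

theorem flatMap_toLetter₂_false (i : Bool) :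
    (cdWord n m ρ i false).flatMap toLetter₂ = cWord n m 0 ρ := by
  have : ∀ l : List (Fin (n + m)), (l.map (a ∘ fun k => (ρ k).val)).flatMap toLetter₂ =
      l.map (fun i => Letter.z (ρ i).val) := by
    intro l
    induction l with
    | nil => rfl
    | cons k l ih => simp [toLetter₂, ih]
  rw [cWord_zero]
  cases i <;> simp [cdWord, dWord, fWord, sWord, swapIf, flatMap_toLetter₂_pairWord, this] <;>
    simp [toLetter₂]

theorem flatMap_toLetter₁_true (j : Bool) :
    (cdWord n m ρ true j).flatMap toLetter₁ ≠ cWord n m 0 ρ := by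
  rw [cWord_zero]
  intro h
  cases j <;> simp [cdWord, dWord, fWord, sWord, swapIf, flatMap_toLetter₁_pairWord] at h <;>
    simp [toLetter₁] at h

theorem flatMap_toLetter₂_true (i : Bool) :
    (cdWord n m ρ i true).flatMap toLetter₂ ≠ cWord n m 0 ρ := by
  rw [cWord_zero]
  intro h
  cases i <;> simp [cdWord, dWord, fWord, sWord, swapIf, flatMap_toLetter₂_pairWord] at h <;>
    simp [toLetter₂] at h

theorem range_append_nodup : (range n ++ range' n m).Nodup := by
  have h := range'_append_1 (s := 0) (m := n) (n := m)
  rw [Nat.zero_add] at h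
  rw [range_eq_range', h]
  exact nodup_range'

theorem map_perm_range : ((finRange (n + m)).map fun k => (ρ k).val) ~ range n ++ range' n m := by
  refine (perm_ext_iff_of_nodup ?_ (range_append_nodup n m)).2 ?_
  · exact (nodup_finRange _).map fun _ _ h => ρ.injective (Fin.ext h)
  · intro k
    simp only [mem_map, mem_finRange, true_and, mem_append, mem_range, mem_range'_1]
    constructor
    · rintro ⟨i, rfl⟩
      have := (ρ i).isLt
      omega
    · intro h
      refine ⟨ρ.symm ⟨k, by omega⟩, by simp⟩

/-- General precedence arguments leave only the four words as candidates. The substitutions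
`toLetter₁` and `toLetter₂` then detect `i` and `j`: each gives `c` exactly when the index concerned
is `false`. -/
theorem cdWord_eq_of_sameImages {i j : Bool} {w : List DLetter}
    (h : SameImages (cWord n m 0 ρ) (cdWord n m ρ i j) w) : w = cdWord n m ρ i j := by
  have hd := range_append_nodup n m
  have hp := map_perm_range n m ρ
  have hk := hp.nodup_iff.2 hd
  obtain ⟨F, rfl, hF, hFs⟩ := SameImages.eq_append (hasCrossings_cWord n m ρ) (T := Twin)
    (fWord_nodup hd i j) (sWord_nodup hk) t₄_notMem_fWord (sWord_subset_fWord hp)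
    (fun _ _ => Twin.symm) (fun e he g hg h1 h2 => exists_separator hd he hg h1 h2)
    (fun e g h1 h2 => exists_between hk h1 h2) h
  obtain ⟨i', j', rfl⟩ := eq_fWord_of_pair_sublist hd hF hFs
  change SameImages _ _ (cdWord n m ρ i' j') at h
  change cdWord n m ρ i' j' = _
  have h1 := h toLetter₁
  have h2 := h toLetter₂
  have e1 := fun j => flatMap_toLetter₁_false n m ρ j
  have e2 := fun i => flatMap_toLetter₂_false n m ρ i
  have n1 := fun j => flatMap_toLetter₁_true n m ρ j
  have n2 := fun i => flatMap_toLetter₂_true n m ρ i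
  have hi : i = i' := by
    cases i <;> cases i' <;> first | rfl | exfalso
    · rw [e1] at h1
      exact n1 _ (h1 (Or.inl (infix_refl _))).symm
    · rw [e1] at h1
      exact n1 _ (h1 (Or.inr (infix_refl _)))
  have hj : j = j' := by
    cases j <;> cases j' <;> first | rfl | exfalso
    · rw [e2] at h2
      exact n2 _ (h2 (Or.inl (infix_refl _))).symm
    · rw [e2] at h2
      exact n2 _ (h2 (Or.inr (infix_refl _)))
  rw [hi, hj]

end DLetter

/-! ### Cutting a word at a letter that occurs once -/

section

variable {α : Type*}

theorem append_cons_inj_of_nodup {a : α} {l₁ l₂ l₃ l₄ : List α} (hn : (l₁ ++ a :: l₂).Nodup)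
    (h : l₁ ++ a :: l₂ = l₃ ++ a :: l₄) : l₁ = l₃ ∧ l₂ = l₄ := by
  have h1 : a ∉ l₁ := fun ha => (nodup_append.1 hn).2.2 a ha a mem_cons_self rfl
  rw [h] at hn
  have h3 : a ∉ l₃ := fun ha => (nodup_append.1 hn).2.2 a ha a mem_cons_self rfl
  clear hn
  induction l₁ generalizing l₃ with
  | nil =>
    cases l₃ with
    | nil => simpa using h
    | cons b l₃ =>
      simp only [nil_append, cons_append, cons.injEq] at h
      exact absurd (h.1 ▸ mem_cons_self) h3
  | cons b l₁ ih =>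
    cases l₃ with
    | nil =>
      simp only [nil_append, cons_append, cons.injEq] at h
      exact absurd (h.1 ▸ mem_cons_self) h1
    | cons b' l₃ =>
      simp only [cons_append, cons.injEq] at h
      rw [mem_cons, not_or] at h1 h3
      obtain ⟨rfl, rfl⟩ := ih h.2 h1.2 h3.2
      exact ⟨by rw [h.1], rfl⟩

theorem exists_of_append_eq_append_cons {τ : α} {L B V W : List α} (hτ : τ ∉ L)
    (h : L ++ B = V ++ τ :: W) : ∃ B', V = L ++ B' ∧ B = B' ++ τ :: W := by
  rcases append_eq_append_iff.1 h with ⟨a, h1, h2⟩ | ⟨a, h1, h2⟩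
  · exact ⟨a, h1, h2⟩
  · cases a with
    | nil => exact ⟨[], by simpa using h1.symm, by simpa using h2.symm⟩
    | cons b a =>
      simp only [cons_append, cons.injEq] at h2
      rw [h1, ← h2.1] at hτ
      simp at hτ

/-- Neither `F` nor `S` repeats a letter, so the two occurrences of `e` lie on opposite sides of
`τ`. -/
theorem exists_of_repeated {τ e : α} {F S A V D : List α} (hF : F.Nodup) (hS : S.Nodup)
    (hτF : τ ∉ F) (hτS : τ ∉ S) (h : F ++ τ :: S = A ++ e :: (V ++ e :: D)) :
    ∃ V' V'', F = A ++ e :: V' ∧ V = V' ++ τ :: V'' ∧ S = V'' ++ e :: D := by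
  rcases append_eq_append_iff.1 h with ⟨a, h1, h2⟩ | ⟨a, h1, h2⟩
  · cases a with
    | nil =>
      simp only [nil_append, cons.injEq] at h2
      rw [h2.2, h2.1] at hτS
      simp at hτS
    | cons b a =>
      simp only [cons_append, cons.injEq] at h2
      rw [h2.2] at hS
      simp [nodup_append] at hS
  · cases a with
    | nil =>
      simp only [nil_append, cons.injEq] at h2
      rw [← h2.2, ← h2.1] at hτS
      simp at hτS
    | cons b a =>
      simp only [cons_append, cons.injEq] at h2
      obtain ⟨rfl, h2⟩ := h2
      rcases append_eq_append_iff.1 h2 with ⟨a', h3, h4⟩ | ⟨a', h3, h4⟩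
      · cases a' with
        | nil =>
          simp only [nil_append, cons.injEq] at h4
          rw [h1, h4.1] at hτF
          simp at hτF
        | cons b a' =>
          simp only [cons_append, cons.injEq] at h4
          rw [h1, h3, ← h4.1] at hF
          simp [nodup_append] at hF
      · cases a' with
        | nil =>
          simp only [nil_append, cons.injEq] at h4
          rw [h1, ← h4.1] at hτF
          simp at hτF
        | cons b a' =>
          simp only [cons_append, cons.injEq] at h4
          obtain ⟨rfl, h4⟩ := h4
          exact ⟨a, a', h1, h3, h4⟩

/-- The first letter of `E` occurs twice, so `τ` lies between its occurrences. As `E` and `G`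
reappear in `S`, they do not contain `τ`, which must therefore be in `B`. -/
theorem exists_of_flip {τ : α} {F S A B C D E G : List α} (hF : F.Nodup) (hS : S.Nodup)
    (hτF : τ ∉ F) (hτS : τ ∉ S) (hE : E ≠ []) (i : Bool)
    (h : F ++ τ :: S = A ++ ((bif i then G ++ E else E ++ G) ++ (B ++ (E ++ (C ++ (G ++ D)))))) :
    ∃ B' V, F = A ++ ((bif i then G ++ E else E ++ G) ++ B') ∧ B = B' ++ τ :: V ∧
      S = V ++ (E ++ (C ++ (G ++ D))) := by
  obtain ⟨e, E, rfl⟩ := exists_cons_of_ne_nil hE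
  cases i with
  | false =>
    obtain ⟨V, W, h1, h2, h3⟩ := exists_of_repeated (A := A) (e := e) (V := E ++ G ++ B)
      (D := E ++ (C ++ (G ++ D))) hF hS hτF hτS (by simpa using h)
    have hτ : τ ∉ E ++ G := by
      intro hm
      refine hτS ?_
      rw [h3]
      simp only [mem_append, mem_cons] at hm ⊢
      tauto
    obtain ⟨B', rfl, h5⟩ := exists_of_append_eq_append_cons hτ h2
    exact ⟨B', W, by simpa using h1, h5, by simpa using h3⟩
  | true =>
    obtain ⟨V, W, h1, h2, h3⟩ := exists_of_repeated (A := A ++ G) (e := e) (V := E ++ B)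
      (D := E ++ (C ++ (G ++ D))) hF hS hτF hτS (by simpa using h)
    have hτ : τ ∉ E := by
      intro hm
      refine hτS ?_
      rw [h3]
      simp only [mem_append, mem_cons] at hm ⊢
      tauto
    obtain ⟨B', rfl, h5⟩ := exists_of_append_eq_append_cons hτ h2
    exact ⟨B', W, by simpa using h1, h5, by simpa using h3⟩

theorem List.IsInfix.of_append_cons {τ : α} {K L M : List α} (hτ : τ ∉ K) (h : K <:+: L ++ τ :: M) :
    K <:+: L ∨ K <:+: M := by
  obtain ⟨U, V, h⟩ := h
  rw [append_assoc] at h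
  rcases append_eq_append_iff.1 h with ⟨a, h1, h2⟩ | ⟨a, h1, h2⟩
  · obtain ⟨B, rfl, h4⟩ := exists_of_append_eq_append_cons hτ h2
    exact Or.inl ⟨U, B, by rw [h1, append_assoc]⟩
  · cases a with
    | nil =>
      simp only [nil_append] at h2
      cases K with
      | nil => exact Or.inl (nil_infix)
      | cons b K =>
        simp only [cons_append, cons.injEq] at h2
        exact absurd (h2.1 ▸ mem_cons_self) hτ
    | cons b a =>
      simp only [cons_append, cons.injEq] at h2
      exact Or.inr ⟨a, V, by rw [h2.2, append_assoc]⟩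

theorem length_flatMap_le {β : Type*} {l : List α} {f : α → List β}
    (h : ∀ k ∈ l, (f k).length ≤ 1) : (l.flatMap f).length ≤ l.length := by
  induction l with
  | nil => simp
  | cons k l ih =>
    have h1 := h k mem_cons_self
    have h2 := ih fun k hk => h k (mem_cons_of_mem _ hk)
    rw [flatMap_cons, length_append, length_cons]
    omega

/-- The total length is unchanged and no letter grows, so no letter can be erased either. -/
theorem eq_singleton_of_flatMap_eq {l : List α} {f : α → List α}
    (h : ∀ k ∈ l, (f k).length ≤ 1) (hl : l.flatMap f = l) : ∀ k ∈ l, f k = [k] := by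
  induction l with
  | nil => simp
  | cons k l ih =>
    have h1 := h k mem_cons_self
    have h2 : ∀ k ∈ l, (f k).length ≤ 1 := fun k hk => h k (mem_cons_of_mem _ hk)
    rw [flatMap_cons] at hl
    match hf : f k with
    | [] =>
      rw [hf] at hl
      have h3 := length_flatMap_le h2
      have h4 := congrArg length hl
      simp only [nil_append, length_cons] at h4
      omega
    | [j] =>
      rw [hf] at hl
      simp only [cons_append, nil_append, cons.injEq] at hl
      intro i hi
      rcases mem_cons.1 hi with rfl | hi
      · rw [hf, hl.1]
      · exact ih h2 hl.2 i hi
    | _ :: _ :: _ =>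
      rw [hf] at h1
      simp at h1

end

/-! ### Substituted copies of the four words inside one another -/

namespace DLetter

/-- The letters that occur twice in `dWord`. -/
def IsRep : DLetter → Prop
  | t₁ | t₂ | t₃ | t₄ | b _ => False
  | _ => True

section

variable {is js ks : List ℕ}

theorem isRep_of_mem_sWord {u : DLetter} (h : u ∈ sWord ks) : IsRep u := by
  rcases mem_sWord.1 h with rfl | rfl | ⟨k, _, rfl⟩ | rfl | rfl | rfl <;> trivial

/-- The simple letters isolate the repeated ones, so the only neighbours that are both repeated are
the two twin pairs. -/
theorem isChain_fWord (i j : Bool) (is js : List ℕ) :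
    (fWord i j is js).IsChain fun u v => IsRep u → IsRep v →
      [u, v] = swapIf i x₁ y₁ ∨ [u, v] = swapIf j x₂ y₂ := by
  have key : ∀ (R : DLetter → DLetter → Prop), (∀ u v, ¬ IsRep u ∨ ¬ IsRep v → R u v) →
      ∀ (l : List ℕ) (M : List DLetter), M.IsChain R → (pairWord l ++ M).IsChain R := by
    intro R hR l M hM
    induction l with
    | nil => exact hM
    | cons k l ih =>
      have h1 : ∀ N : List DLetter, N.IsChain R → (b k :: N).IsChain R := by
        intro N hN
        cases N with
        | nil => simp
        | cons c N => exact isChain_cons_cons.2 ⟨hR _ _ (Or.inl id), hN⟩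
      exact isChain_cons_cons.2 ⟨hR _ _ (Or.inr id), h1 _ ih⟩
  have h0 : (pairWord js).IsChain fun u v => IsRep u → IsRep v →
      [u, v] = swapIf i x₁ y₁ ∨ [u, v] = swapIf j x₂ y₂ := by
    have := key _ (fun u v h h1 h2 => (h.elim (absurd h1) (absurd h2) :
      [u, v] = swapIf i x₁ y₁ ∨ [u, v] = swapIf j x₂ y₂)) js [] IsChain.nil
    simpa using this
  refine key _ (fun u v h h1 h2 => h.elim (absurd h1) (absurd h2)) _ _ ?_
  have h3 : (t₃ :: pairWord js).IsChain fun u v => IsRep u → IsRep v →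
      [u, v] = swapIf i x₁ y₁ ∨ [u, v] = swapIf j x₂ y₂ := by
    cases hp : pairWord js with
    | nil => simp
    | cons c N => exact isChain_cons_cons.2 ⟨fun h => h.elim, hp ▸ h0⟩
  cases i <;> cases j <;> simp [swapIf, isChain_cons_cons] <;> simp [IsRep] <;>
    simpa [swapIf, IsRep] using h3

theorem eq_swapIf_of_infix {i j : Bool} {K : List DLetter} (h : K <:+: fWord i j is js)
    (hK : ∀ u ∈ K, IsRep u) (hl : 2 ≤ K.length) :
    K = swapIf i x₁ y₁ ∨ K = swapIf j x₂ y₂ := by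
  have hc := (isChain_fWord i j is js).infix h
  match K with
  | [] => simp at hl
  | [_] => simp at hl
  | [u, v] =>
    rw [isChain_cons_cons] at hc
    exact hc.1 (hK u (by simp)) (hK v (by simp))
  | u :: v :: w :: K =>
    rw [isChain_cons_cons, isChain_cons_cons] at hc
    have h1 := hc.1 (hK u (by simp)) (hK v (by simp))
    have h2 := hc.2.1 (hK v (by simp)) (hK w (by simp))
    exfalso
    cases i <;> cases j <;> simp [swapIf] at h1 h2 <;>
      rcases h1 with ⟨rfl, rfl⟩ | ⟨rfl, rfl⟩ <;> simp at h2

/-- A longer common factor would be a twin pair, but twins are not adjacent in `sWord`, where `p`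
separates them. -/
theorem length_le_one_of_infix {i j : Bool} {K : List DLetter} (hk : ks.Nodup)
    (h : K <:+: fWord i j is js) (h' : K <:+: sWord ks) : K.length ≤ 1 := by
  by_contra! hl
  have hrep : ∀ u ∈ K, IsRep u := fun u hu => isRep_of_mem_sWord (h'.subset hu)
  have hT : ∃ u v, K = [u, v] ∧ Twin u v := by
    rcases eq_swapIf_of_infix h hrep hl with rfl | rfl
    · cases i
      exacts [⟨_, _, rfl, by simp [Twin]⟩, ⟨_, _, rfl, by simp [Twin]⟩]
    · cases j
      exacts [⟨_, _, rfl, by simp [Twin]⟩, ⟨_, _, rfl, by simp [Twin]⟩]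
  obtain ⟨u, v, rfl, ht⟩ := hT
  obtain ⟨q, -, -, h1, h2⟩ := exists_between hk ht h'.sublist
  obtain ⟨U, V, hUV⟩ := h'
  have e : U ++ u :: v :: V = sWord ks := by rw [← hUV]; simp
  have hn := sWord_nodup hk
  rw [← e] at h1 h2 hn
  exact hn.not_between h1 h2

/-- The words `E` and `G` recur in `sWord`, so their first occurrences form a factor of `fWord` with
only repeated letters and length at least two: a twin pair. Thus `E` and `G` are single letters, and
their order in `sWord` decides which is which. -/
theorem exists_of_dWord_eq_flip {i i' j' : Bool} {A B C D E G : List DLetter}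
    (hd : (is ++ js).Nodup) (hk : ks ~ is ++ js) (hE : E ≠ []) (hG : G ≠ [])
    (h : dWord i' j' is js ks =
      A ++ ((bif i then G ++ E else E ++ G) ++ (B ++ (E ++ (C ++ (G ++ D)))))) :
    ∃ B' V, B = B' ++ t₄ :: V ∧
      ((E = [x₁] ∧ G = [y₁] ∧ i = i' ∧ fWord i' j' is js = A ++ (swapIf i' x₁ y₁ ++ B') ∧
        sWord ks = V ++ x₁ :: (C ++ y₁ :: D)) ∨
      (E = [x₂] ∧ G = [y₂] ∧ i = j' ∧ fWord i' j' is js = A ++ (swapIf j' x₂ y₂ ++ B') ∧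
        sWord ks = V ++ x₂ :: (C ++ y₂ :: D))) := by
  have hkn := hk.nodup_iff.2 hd
  have hSn := sWord_nodup hkn
  have ht : t₄ ∉ sWord ks := by simp [mem_sWord]
  obtain ⟨B', V, h1, h2, h3⟩ := exists_of_flip (fWord_nodup hd i' j') hSn
    t₄_notMem_fWord ht hE i h
  refine ⟨B', V, h2, ?_⟩
  have hX : (bif i then G ++ E else E ++ G) = swapIf i' x₁ y₁ ∨
      (bif i then G ++ E else E ++ G) = swapIf j' x₂ y₂ := by
    refine eq_swapIf_of_infix (is := is) (js := js) ⟨A, B', by rw [h1, append_assoc]⟩ ?_ ?_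
    · intro u hu
      refine isRep_of_mem_sWord (ks := ks) ?_
      rw [h3]
      cases i <;> simp only [cond_true, cond_false, mem_append] at hu ⊢ <;> tauto
    · have := length_pos_iff.2 hE
      have := length_pos_iff.2 hG
      cases i <;> simp only [cond_true, cond_false, length_append] <;> omega
  have hlen : E.length = 1 ∧ G.length = 1 := by
    have h4 : (bif i then G ++ E else E ++ G).length = 2 := by
      rcases hX with hX | hX <;> rw [hX]
      · cases i' <;> rfl
      · cases j' <;> rfl
    have := length_pos_iff.2 hE
    have := length_pos_iff.2 hG
    cases i <;> simp only [cond_true, cond_false, length_append] at h4 <;> omega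
  obtain ⟨e, rfl⟩ := length_eq_one_iff.1 hlen.1
  obtain ⟨g, rfl⟩ := length_eq_one_iff.1 hlen.2
  have heg : [e, g] <+ sWord ks := by
    rw [h3]
    exact ((sublist_append_left [g] D).trans (sublist_append_right C _)).cons_cons e |>.trans
      (sublist_append_right V _)
  -- In `sWord` each `x` precedes its `y`; this excludes the case where `E` is a `y`.
  have h5 : ¬ [y₁, x₁] <+ sWord ks := by
    refine hSn.pair_sublist_asymm ?_
    simp [sWord]
  have h6 : ¬ [y₂, x₂] <+ sWord ks := by
    refine hSn.pair_sublist_asymm ?_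
    simp [sWord]
  have hX' : (i = i' ∧ e = x₁ ∧ g = y₁) ∨ (i = j' ∧ e = x₂ ∧ g = y₂) := by
    rcases hX with hX | hX
    · left
      cases i <;> cases i' <;> simp [swapIf] at hX <;> obtain ⟨rfl, rfl⟩ := hX <;>
        first | exact ⟨rfl, rfl, rfl⟩ | exact absurd heg h5
    · right
      cases i <;> cases j' <;> simp [swapIf] at hX <;> obtain ⟨rfl, rfl⟩ := hX <;>
        first | exact ⟨rfl, rfl, rfl⟩ | exact absurd heg h6
  rcases hX' with ⟨rfl, rfl, rfl⟩ | ⟨rfl, rfl, rfl⟩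
  · refine Or.inl ⟨rfl, rfl, rfl, ?_, by simpa using h3⟩
    rw [h1]
    cases i <;> rfl
  · refine Or.inr ⟨rfl, rfl, rfl, ?_, by simpa using h3⟩
    rw [h1]
    cases i <;> rfl

theorem append_swapIf_inj {i : Bool} {u v : DLetter} {A B A' B' : List DLetter}
    (hn : (A ++ (swapIf i u v ++ B)).Nodup)
    (h : A ++ (swapIf i u v ++ B) = A' ++ (swapIf i u v ++ B')) : A = A' ∧ B = B' := by
  cases i
  · obtain ⟨h1, h2⟩ := append_cons_inj_of_nodup (a := u) (l₂ := v :: B) (l₄ := v :: B') hn h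
    exact ⟨h1, (cons.inj h2).2⟩
  · obtain ⟨h1, h2⟩ := append_cons_inj_of_nodup (a := v) (l₂ := u :: B) (l₄ := u :: B') hn h
    exact ⟨h1, (cons.inj h2).2⟩

theorem eq_of_sWord_eq₁ {V C D : List DLetter} (hk : ks.Nodup)
    (h : sWord ks = V ++ x₁ :: (C ++ y₁ :: D)) :
    V = [] ∧ C = x₂ :: (ks.map a ++ [p, y₂]) ∧ D = [] := by
  have hn := sWord_nodup hk
  have h1 := append_cons_inj_of_nodup (l₁ := []) (a := x₁) (by exact hn) h
  have h2 : (x₂ :: (ks.map a ++ [p, y₂])) ++ y₁ :: [] = C ++ y₁ :: D := by simpa using h1.2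
  have h3 := append_cons_inj_of_nodup (by simpa using (nodup_cons.1 hn).2) h2
  exact ⟨h1.1.symm, h3.1.symm, h3.2.symm⟩

theorem eq_of_sWord_eq₂ {V C D : List DLetter} (hk : ks.Nodup)
    (h : sWord ks = V ++ x₂ :: (C ++ y₂ :: D)) :
    V = [x₁] ∧ C = ks.map a ++ [p] ∧ D = [y₁] := by
  have hn := sWord_nodup hk
  have h1 := append_cons_inj_of_nodup (l₁ := [x₁]) (a := x₂) (by exact hn) h
  have h2 : (ks.map a ++ [p]) ++ y₂ :: [y₁] = C ++ y₂ :: D := by simpa using h1.2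
  have h3 := append_cons_inj_of_nodup
    (by simpa using (nodup_cons.1 (nodup_cons.1 hn).2).2) h2
  exact ⟨h1.1.symm, h3.1.symm, h3.2.symm⟩

theorem eq_of_fWord_eq₁ {i j : Bool} {A B : List DLetter} (hd : (is ++ js).Nodup)
    (h : fWord i j is js = A ++ (swapIf i x₁ y₁ ++ B)) :
    A = pairWord is ∧ B = t₁ :: p :: t₂ :: (swapIf j x₂ y₂ ++ t₃ :: pairWord js) := by
  have := append_swapIf_inj (fWord_nodup hd i j) h
  exact ⟨this.1.symm, this.2.symm⟩

theorem eq_of_fWord_eq₂ {i j : Bool} {A B : List DLetter} (hd : (is ++ js).Nodup)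
    (h : fWord i j is js = A ++ (swapIf j x₂ y₂ ++ B)) :
    A = pairWord is ++ (swapIf i x₁ y₁ ++ [t₁, p, t₂]) ∧ B = t₃ :: pairWord js := by
  have e : fWord i j is js = (pairWord is ++ (swapIf i x₁ y₁ ++ [t₁, p, t₂])) ++
      (swapIf j x₂ y₂ ++ t₃ :: pairWord js) := by
    simp [fWord]
  have := append_swapIf_inj (e ▸ fWord_nodup hd i j) (e ▸ h)
  exact ⟨this.1.symm, this.2.symm⟩

/-- A letter of the part of a word that lies between the second occurrences of two flipped letters
is sent to a word of length at most one. -/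
theorem length_le_one_of_flip {i j : Bool} {A X B V W K C : List DLetter} (hk : ks.Nodup)
    (hF : fWord i j is js = A ++ (X ++ B)) (hS : sWord ks = V ++ W) (hC : C <:+: W)
    (hK : K <:+: C) (h : K <:+: A ∨ K <:+: B ++ t₄ :: V) : K.length ≤ 1 := by
  have hKW := hK.trans hC
  have hKS : K <:+: sWord ks := by
    rw [hS]
    exact hKW.trans (suffix_append _ _).isInfix
  refine length_le_one_of_infix hk (i := i) (j := j) (is := is) (js := js) ?_ hKS
  rw [hF]
  rcases h with h | h
  · exact h.trans (prefix_append _ _).isInfix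
  · have ht : t₄ ∉ K := fun h => by simpa [mem_sWord] using hKS.subset h
    rcases h.of_append_cons ht with h | h
    · exact h.trans ((suffix_append _ _).trans (suffix_append _ _)).isInfix
    · cases K with
      | nil => exact nil_infix
      | cons u K =>
        have hn := sWord_nodup hk
        rw [hS] at hn
        exact absurd rfl
          ((nodup_append.1 hn).2.2 u (h.subset mem_cons_self) u (hKW.subset mem_cons_self))

theorem infix_flatMap {l : List DLetter} {f : DLetter → List DLetter} {k : DLetter} (h : k ∈ l) :
    f k <:+: l.flatMap f := by
  obtain ⟨l₁, l₂, rfl⟩ := append_of_mem h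
  exact ⟨l₁.flatMap f, l₂.flatMap f, by simp⟩

theorem flatMap_swapIf {i : Bool} {u v : DLetter} {f : DLetter → List DLetter} :
    (swapIf i u v).flatMap f = bif i then f v ++ f u else f u ++ f v := by
  cases i <;> simp [swapIf]

/-- The image is regrouped around the outer pair, in the shape required by
`exists_of_dWord_eq_flip`. -/
theorem flatMap_dWord₁ {i j : Bool} {l r : List DLetter} {f : DLetter → List DLetter} :
    l ++ ((dWord i j is js ks).flatMap f ++ r) = (l ++ (pairWord is).flatMap f) ++
      ((bif i then f y₁ ++ f x₁ else f x₁ ++ f y₁) ++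
      ((t₁ :: p :: t₂ :: (swapIf j x₂ y₂ ++ t₃ :: (pairWord js ++ [t₄]))).flatMap f ++
      (f x₁ ++ ((x₂ :: (ks.map a ++ [p, y₂])).flatMap f ++ (f y₁ ++ r))))) := by
  rw [← flatMap_swapIf]
  simp only [dWord, fWord, sWord, flatMap_append, flatMap_cons, append_assoc, flatMap_nil,
    append_nil, cons_append]

theorem flatMap_dWord₂ {i j : Bool} {l r : List DLetter} {f : DLetter → List DLetter} :
    l ++ ((dWord i j is js ks).flatMap f ++ r) =
      (l ++ (pairWord is ++ (swapIf i x₁ y₁ ++ [t₁, p, t₂])).flatMap f) ++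
      ((bif j then f y₂ ++ f x₂ else f x₂ ++ f y₂) ++
      ((t₃ :: (pairWord js ++ [t₄, x₁])).flatMap f ++
      (f x₂ ++ ((ks.map a ++ [p]).flatMap f ++ (f y₂ ++ (f y₁ ++ r)))))) := by
  rw [← flatMap_swapIf]
  simp only [dWord, fWord, sWord, flatMap_append, flatMap_cons, append_assoc, flatMap_nil,
    append_nil, cons_append]

/-- The images of `x₂, y₂` are a twin pair of the target. If it is `x₂, y₂`, exchanging them gives
the other word. It cannot be the outer pair: the `|ks| + 1` letters between the second occurrences
of `x₂` and `y₂` have images of length at most one, too short to fill the `|ks| + 3` places between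
`x₁` and `y₁`. -/
theorem flip₂ {i j i' j' : Bool} {l r : List DLetter} {f : DLetter → List DLetter}
    (hd : (is ++ js).Nodup) (hk : ks ~ is ++ js) (hx : f x₂ ≠ []) (hy : f y₂ ≠ [])
    (h : l ++ ((dWord i j is js ks).flatMap f ++ r) = dWord i' j' is js ks) :
    l ++ ((dWord i (!j) is js ks).flatMap f ++ r) = dWord i' (!j') is js ks := by
  have hkn := hk.nodup_iff.2 hd
  rw [flatMap_dWord₂] at h ⊢
  obtain ⟨B', V, hB, H⟩ := exists_of_dWord_eq_flip hd hk hx hy h.symm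
  rcases H with ⟨hE, hG, rfl, hF, hS⟩ | ⟨hE, hG, rfl, hF, hS⟩
  · exfalso
    have hlen : ∀ k ∈ ks.map a ++ [p], (f k).length ≤ 1 := by
      intro k hk'
      refine length_le_one_of_flip hkn hF hS
        (C := (ks.map a ++ [p]).flatMap f) ⟨[x₁], y₁ :: (f y₁ ++ r), by simp⟩
        (infix_flatMap hk') ?_
      rw [← hB]
      have hk2 : k ∈ pairWord is ++ (swapIf i x₁ y₁ ++ [t₁, p, t₂]) ∨
          k ∈ t₃ :: (pairWord js ++ [t₄, x₁]) := by
        simp only [mem_append, mem_map, mem_singleton] at hk'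
        rcases hk' with ⟨q, hq, rfl⟩ | rfl
        · rw [hk.mem_iff, mem_append] at hq
          simpa [mem_pairWord, mem_swapIf] using hq
        · simp
      rcases hk2 with hk2 | hk2
      · exact Or.inl ((infix_flatMap hk2).trans (suffix_append _ _).isInfix)
      · exact Or.inr (infix_flatMap hk2)
    have h1 := length_flatMap_le hlen
    rw [(eq_of_sWord_eq₁ hkn hS).2.1] at h1
    simp at h1
  · obtain ⟨rfl, hC, hD⟩ := eq_of_sWord_eq₂ hkn hS
    obtain ⟨hA, rfl⟩ := eq_of_fWord_eq₂ hd hF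
    rw [hA, hB, hC, hD, hE, hG]
    cases j <;> simp [dWord, fWord, sWord, swapIf]

/-- If `x₁, y₁` are mapped to themselves, the segment between their second occurrences is mapped
onto itself by a substitution that lengthens no letter of it. Such a substitution fixes `x₂` and
`y₂`, whence `j = j'`. Mapping `x₁, y₁` to the inner pair is excluded by a count of letters that
relies on the position of `p`. -/
theorem flip₁ {i j i' j' : Bool} {l r : List DLetter} {f : DLetter → List DLetter}
    (hd : (is ++ js).Nodup) (hk : ks ~ is ++ js) (hx : f x₁ ≠ []) (hy : f y₁ ≠ [])
    (h : l ++ ((dWord i j is js ks).flatMap f ++ r) = dWord i' j' is js ks) :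
    j = j' ∧ l ++ ((dWord (!i) j is js ks).flatMap f ++ r) = dWord (!i') j' is js ks := by
  have hkn := hk.nodup_iff.2 hd
  rw [flatMap_dWord₁] at h ⊢
  obtain ⟨B', V, hB, H⟩ := exists_of_dWord_eq_flip hd hk hx hy h.symm
  have hlen : ∀ (X : List DLetter) (u v : DLetter),
      fWord i' j' is js = (l ++ (pairWord is).flatMap f) ++ (X ++ B') →
      sWord ks = V ++ u :: ((x₂ :: (ks.map a ++ [p, y₂])).flatMap f ++ v :: r) →
      ∀ k ∈ x₂ :: (ks.map a ++ [p, y₂]), (f k).length ≤ 1 := by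
    intro X u v hF hS k hk'
    refine length_le_one_of_flip hkn hF hS
      (C := (x₂ :: (ks.map a ++ [p, y₂])).flatMap f) ⟨[u], v :: r, by simp⟩
      (infix_flatMap hk') ?_
    rw [← hB]
    have hk2 : k ∈ pairWord is ∨
        k ∈ t₁ :: p :: t₂ :: (swapIf j x₂ y₂ ++ t₃ :: (pairWord js ++ [t₄])) := by
      simp only [mem_append, mem_map, mem_cons, not_mem_nil, or_false] at hk'
      rcases hk' with rfl | ⟨q, hq, rfl⟩ | rfl | rfl
      · simp [mem_swapIf]
      · rw [hk.mem_iff, mem_append] at hq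
        simpa [mem_pairWord, mem_swapIf] using hq
      · simp
      · simp [mem_swapIf]
    rcases hk2 with hk2 | hk2
    · exact Or.inl ((infix_flatMap hk2).trans (suffix_append _ _).isInfix)
    · exact Or.inr (infix_flatMap hk2)
  rcases H with ⟨hE, hG, rfl, hF, hS⟩ | ⟨hE, hG, rfl, hF, hS⟩
  · replace hlen := hlen _ _ _ hF hS
    obtain ⟨rfl, hC, hD⟩ := eq_of_sWord_eq₁ hkn hS
    obtain ⟨hA, hB'⟩ := eq_of_fWord_eq₁ hd hF
    constructor
    · have hfix := eq_singleton_of_flatMap_eq hlen hC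
      have hx₂ := hfix x₂ (by simp)
      have hy₂ := hfix y₂ (by simp)
      -- As `x₂` and `y₂` are fixed, their order in the source survives in the image, where it meets
      -- the order prescribed by `j'`.
      have h1 : swapIf j x₂ y₂ <+ B' ++ [t₄] := by
        rw [← hB]
        simp only [flatMap_cons, flatMap_append]
        refine Sublist.trans ?_ (sublist_append_right _ _)
        refine Sublist.trans ?_ (sublist_append_right _ _)
        refine Sublist.trans ?_ (sublist_append_right _ _)
        refine Sublist.trans ?_ (sublist_append_left _ _)
        rw [flatMap_swapIf, hx₂, hy₂]
        cases j <;> exact Sublist.refl _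
      have h2 : swapIf j' x₂ y₂ <+ B' := by
        rw [hB']
        exact (((sublist_append_left _ _).cons _).cons _).cons _
      have hn : B'.Nodup := by
        have := fWord_nodup hd i j'
        rw [hF] at this
        exact (nodup_append.1 (nodup_append.1 this).2.1).2.1
      have h3 := hn.pair_sublist_asymm (a := x₂) (b := y₂)
      have h4 : ∀ u v, v ≠ t₄ → [u, v] <+ B' ++ [t₄] → [u, v] <+ B' := by
        intro u v hv
        simp [pair_sublist_append_iff, hv]
      cases j <;> cases j' <;> first | rfl | exfalso
      · exact h3 (h4 _ _ (by simp) h1) h2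
      · exact h3 h2 (h4 _ _ (by simp) h1)
    · rw [hA, hB, hC, hD, hE, hG, hB']
      cases i <;> simp [dWord, fWord, sWord, swapIf]
  · exfalso
    replace hlen := hlen _ _ _ hF hS
    obtain ⟨rfl, hC, hD⟩ := eq_of_sWord_eq₂ hkn hS
    obtain ⟨hA, -⟩ := eq_of_fWord_eq₂ hd hF
    have hFn := fWord_nodup hd i' i
    have hSn := sWord_nodup hkn
    -- In the target, `p` and the `a k` with `k ∈ is` occur before the inner pair and again between
    -- its second occurrences. A source letter that produces one of them cannot occur in the part
    -- mapped to `B`, so it is some `a k` with `k ∈ is`. This gives `|is| + 1` distinct letters in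
    -- the images of `|is|` letters, each of length at most one.
    have hsub : p :: is.map a ⊆ (is.map a).flatMap f := by
      intro q hq
      have hqC : q ∈ (x₂ :: (ks.map a ++ [p, y₂])).flatMap f := by
        rw [hC]
        simp only [mem_cons, mem_map, mem_append, not_mem_nil, or_false] at hq ⊢
        rcases hq with rfl | ⟨k, hk', rfl⟩
        · exact Or.inr rfl
        · exact Or.inl ⟨k, hk.mem_iff.2 (mem_append_left _ hk'), rfl⟩
      have hqA : q ∈ l ++ (pairWord is).flatMap f := by
        rw [hA]
        simp only [mem_cons, mem_map] at hq
        rcases hq with rfl | ⟨k, hk', rfl⟩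
        · simp
        · simp [mem_pairWord, hk']
      have hqB : q ∉ (t₁ :: p :: t₂ ::
          (swapIf j x₂ y₂ ++ t₃ :: (pairWord js ++ [t₄]))).flatMap f := by
        rw [hB, mem_append, mem_cons, mem_singleton]
        rintro (h1 | rfl | rfl)
        · rw [hF] at hFn
          exact (nodup_append.1 hFn).2.2 q hqA q (mem_append_right _ h1) rfl
        · simp at hq
        · simp at hq
      obtain ⟨k, hk1, hk2⟩ := mem_flatMap.1 hqC
      have hk3 : k ∉ t₁ :: p :: t₂ :: (swapIf j x₂ y₂ ++ t₃ :: (pairWord js ++ [t₄])) :=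
        fun h => hqB (mem_flatMap.2 ⟨k, h, hk2⟩)
      refine mem_flatMap.2 ⟨k, ?_, hk2⟩
      simp only [mem_cons, mem_map, mem_append, not_mem_nil, or_false, mem_swapIf,
        not_or, mem_pairWord] at hk1 hk3
      rcases hk1 with rfl | ⟨q', hq', rfl⟩ | rfl | rfl
      · exact absurd rfl hk3.2.2.2.1.1
      · rw [hk.mem_iff, mem_append] at hq'
        rcases hq' with hq' | hq'
        · exact mem_map_of_mem hq'
        · exact absurd ⟨q', hq', Or.inl rfl⟩ hk3.2.2.2.2.2.1
      · exact absurd rfl hk3.2.1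
      · exact absurd rfl hk3.2.2.2.1.2
    have hnod : (p :: is.map a).Nodup := by
      have : (is.map a).Nodup :=
        (nodup_append.1 hd).1.map fun _ _ h => by injection h
      simp [this]
    have h1 := (hnod.subperm hsub).length_le
    have h2 : ((is.map a).flatMap f).length ≤ (is.map a).length := by
      refine length_flatMap_le fun k hk' => hlen k ?_
      obtain ⟨q, hq, rfl⟩ := mem_map.1 hk'
      exact mem_cons_of_mem _ (mem_append_left _
        (mem_map_of_mem (hk.mem_iff.2 (mem_append_left _ hq))))
    rw [length_cons] at h1
    omega

theorem flatMap_dWord_eq₁ {i j : Bool} {f : DLetter → List DLetter} (h : f x₁ = [] ∨ f y₁ = []) :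
    (dWord (!i) j is js ks).flatMap f = (dWord i j is js ks).flatMap f := by
  rcases h with h | h <;> cases i <;> simp [dWord, fWord, swapIf, h]

theorem flatMap_dWord_eq₂ {i j : Bool} {f : DLetter → List DLetter} (h : f x₂ = [] ∨ f y₂ = []) :
    (dWord i (!j) is js ks).flatMap f = (dWord i j is js ks).flatMap f := by
  rcases h with h | h <;> cases j <;> simp [dWord, fWord, swapIf, h]

end

end DLetter

/-! ### The syntactic monoids of the pentagon -/

namespace DLetter

variable (n m : ℕ) (ρ : Equiv.Perm (Fin (n + m)))

theorem mul_map_mul_mem_iff {T : Set (FreeMonoid DLetter)} {u v : List DLetter}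
    (huv : ∀ (f : DLetter → List DLetter) (l r : List DLetter),
      FreeMonoid.ofList (l ++ (u.flatMap f ++ r)) ∈ T →
        FreeMonoid.ofList (l ++ (v.flatMap f ++ r)) ∈ T)
    (hvu : ∀ (f : DLetter → List DLetter) (l r : List DLetter),
      FreeMonoid.ofList (l ++ (v.flatMap f ++ r)) ∈ T →
        FreeMonoid.ofList (l ++ (u.flatMap f ++ r)) ∈ T) :
    MonoidVariety.Satisfies (MonoidVariety.SyntacticMonoid T) (FreeMonoid.ofList u)
      (FreeMonoid.ofList v) := by
  refine MonoidVariety.satisfies_syntacticMonoid fun φ l r => ?_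
  let f : DLetter → List DLetter := fun k => (φ (FreeMonoid.of k)).toList
  have hφ : ∀ w : List DLetter, φ (FreeMonoid.ofList w) = FreeMonoid.ofList (w.flatMap f) := by
    intro w
    induction w with
    | nil => exact map_one φ
    | cons k w ih => rw [FreeMonoid.ofList_cons, map_mul, ih]; rfl
  have e : ∀ w : List DLetter, l * φ (FreeMonoid.ofList w) * r =
      FreeMonoid.ofList (l.toList ++ (w.flatMap f ++ r.toList)) := by
    intro w
    rw [hφ, mul_assoc]
    rfl
  rw [e, e]
  exact ⟨huv f _ _, hvu f _ _⟩

/-- If a letter of the flipped pair is erased, the flip has no effect on the image; otherwise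
`flip₁` applies. -/
theorem flip_cdWord₁ {i j i' j' : Bool} {l r : List DLetter} {f : DLetter → List DLetter}
    (h : l ++ ((cdWord n m ρ i j).flatMap f ++ r) = cdWord n m ρ i' j') :
    l ++ ((cdWord n m ρ (!i) j).flatMap f ++ r) = cdWord n m ρ i' j' ∨
      (j = j' ∧ l ++ ((cdWord n m ρ (!i) j).flatMap f ++ r) = cdWord n m ρ (!i') j') := by
  by_cases hf : f x₁ = [] ∨ f y₁ = []
  · left
    rw [← h]
    unfold cdWord
    rw [flatMap_dWord_eq₁ hf]
  · rw [not_or] at hf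
    exact Or.inr (flip₁ (range_append_nodup n m) (map_perm_range n m ρ) hf.1 hf.2 h)

theorem flip_cdWord₂ {i j i' j' : Bool} {l r : List DLetter} {f : DLetter → List DLetter}
    (h : l ++ ((cdWord n m ρ i j).flatMap f ++ r) = cdWord n m ρ i' j') :
    l ++ ((cdWord n m ρ i (!j)).flatMap f ++ r) = cdWord n m ρ i' j' ∨
      l ++ ((cdWord n m ρ i (!j)).flatMap f ++ r) = cdWord n m ρ i' (!j') := by
  by_cases hf : f x₂ = [] ∨ f y₂ = []
  · left
    rw [← h]
    unfold cdWord
    rw [flatMap_dWord_eq₂ hf]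
  · rw [not_or] at hf
    exact Or.inr (flip₂ (range_append_nodup n m) (map_perm_range n m ρ) hf.1 hf.2 h)

theorem cdWord_ne₁ (j j' : Bool) : cdWord n m ρ true j ≠ cdWord n m ρ false j' := by
  intro h
  have := flatMap_toLetter₁_true n m ρ j
  rw [h] at this
  exact this (flatMap_toLetter₁_false n m ρ j')

theorem syntacticMonoid_mem {T : Set (FreeMonoid DLetter)}
    (hT : ∀ w ∈ T, ∃ i j, w = FreeMonoid.ofList (cdWord n m ρ i j)) :
    MonCat.of (MonoidVariety.SyntacticMonoid T) ∈
      (MonoidVariety.generatedBy (FactorMonoid (cWord n m 0 ρ))).carrier := by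
  refine MonoidVariety.syntacticMonoid_mem_generatedBy fun p q hpq hp => ?_
  obtain ⟨i, j, rfl⟩ := hT p hp
  have : q = FreeMonoid.ofList (cdWord n m ρ i j) := cdWord_eq_of_sameImages n m ρ hpq.sameImages
  rwa [this]

end DLetter

open DLetter in
theorem mainTheorem5 (n m : ℕ) (ρ : Equiv.Perm (Fin (n + m))) :
    ¬ IsModularLattice
        (MonoidVariety.generatedBy (FactorMonoid (cWord n m 0 ρ))).SubvarietyLattice ∧
      ¬ ∀ A B C : (MonoidVariety.generatedBy (FactorMonoid (cWord n m 0 ρ))).SubvarietyLattice,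
          A ⊓ (B ⊔ C) = (A ⊓ B) ⊔ (A ⊓ C) := by
  refine MonoidVariety.not_modular_and_not_distrib
    (MonoidVariety.exists_not_modular (w := fun i j => FreeMonoid.ofList (cdWord n m ρ i j))
      (cdWord_ne₁ n m ρ _ _) (cdWord_ne₁ n m ρ _ _) (syntacticMonoid_mem n m ρ ?_)
      (syntacticMonoid_mem n m ρ ?_) (fun j => ?_) (fun i => ?_) ?_)
  · rintro _ (rfl | rfl)
    exacts [⟨_, _, rfl⟩, ⟨_, _, rfl⟩]
  · rintro _ (rfl | rfl)
    exacts [⟨_, _, rfl⟩, ⟨_, _, rfl⟩]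
  · have H : ∀ (i : Bool) (f : DLetter → List DLetter) (l r : List DLetter),
        FreeMonoid.ofList (l ++ ((cdWord n m ρ i j).flatMap f ++ r)) ∈
          ({FreeMonoid.ofList (cdWord n m ρ false false),
            FreeMonoid.ofList (cdWord n m ρ true false)} : Set (FreeMonoid DLetter)) →
        FreeMonoid.ofList (l ++ ((cdWord n m ρ (!i) j).flatMap f ++ r)) ∈
          ({FreeMonoid.ofList (cdWord n m ρ false false),
            FreeMonoid.ofList (cdWord n m ρ true false)} : Set (FreeMonoid DLetter)) := by
      rintro i f l r (h | h)
      · rcases flip_cdWord₁ n m ρ h with h | ⟨-, h⟩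
        exacts [Or.inl h, Or.inr h]
      · rcases flip_cdWord₁ n m ρ h with h | ⟨-, h⟩
        exacts [Or.inr h, Or.inl h]
    exact mul_map_mul_mem_iff (H false) (H true)
  · have H : ∀ (j : Bool) (f : DLetter → List DLetter) (l r : List DLetter),
        FreeMonoid.ofList (l ++ ((cdWord n m ρ i j).flatMap f ++ r)) ∈
          ({FreeMonoid.ofList (cdWord n m ρ false false),
            FreeMonoid.ofList (cdWord n m ρ false true)} : Set (FreeMonoid DLetter)) →
        FreeMonoid.ofList (l ++ ((cdWord n m ρ i (!j)).flatMap f ++ r)) ∈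
          ({FreeMonoid.ofList (cdWord n m ρ false false),
            FreeMonoid.ofList (cdWord n m ρ false true)} : Set (FreeMonoid DLetter)) := by
      rintro j f l r (h | h)
      · rcases flip_cdWord₂ n m ρ h with h | h
        exacts [Or.inl h, Or.inr h]
      · rcases flip_cdWord₂ n m ρ h with h | h
        exacts [Or.inr h, Or.inl h]
    exact mul_map_mul_mem_iff (H false) (H true)
  -- A nontrivial flip would require the second indices to agree, but the source has `true` and the
  -- target `false`.
  · have H : ∀ (i : Bool) (f : DLetter → List DLetter) (l r : List DLetter),
        FreeMonoid.ofList (l ++ ((cdWord n m ρ i true).flatMap f ++ r)) ∈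
          ({FreeMonoid.ofList (cdWord n m ρ false false)} : Set (FreeMonoid DLetter)) →
        FreeMonoid.ofList (l ++ ((cdWord n m ρ (!i) true).flatMap f ++ r)) ∈
          ({FreeMonoid.ofList (cdWord n m ρ false false)} : Set (FreeMonoid DLetter)) := by
      intro i f l r h
      rcases flip_cdWord₁ n m ρ h with h | ⟨h, -⟩
      exacts [h, by cases h]
    exact mul_map_mul_mem_iff (H false) (H true)
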